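/- Assume Jensen's principle $\diamondsuit$: there are sets $A_\alpha\subseteq\alpha$ $(\alpha<\omega_1)$ such that for every $A\subseteq\omega_1$ the set $\{\alpha<\omega_1 : A\cap\alpha=A_\alpha\}$ is stationary in $\omega_1$. For a real number $C\ge 1$, a sequence $(y_\alpha)_{\alpha<\omega_1}$ of nonzero vectors in a real Banach space is called an uncountable $C$-basic sequence if $$\Bigl\|\sum_{\alpha<\lambda}a_\alpha y_\alpha\Bigr\|\le C\,\Bigl\|\sum_{\alpha<\omega_1}a_\alpha y_\alpha\Bigr\|$$ for every $\lambda<\omega_1$ and every finitely supported family $(a_\alpha)_{\alpha<\omega_1}$ of reals; it is a $C$-basis of length $\omega_1$ of the space if moreover its closed linear span is the whole space. Then for every real $K>1$ there is a real Banach space $\mathcal X_K$ that has a $K$-basis $(e_\alpha)_{\alpha<\omega_1}$ of length $\omega_1$ with $\|e_\alpha\|=1$ for all $\alpha$, but that has no uncountable $K'$-basic sequence for any $1\le K'<K$. -/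

import Mathlib

open scoped Ordinal

/-- The well-ordered set `ω₁`: a concrete type of order type the first uncountable ordinal.
Its elements play the role of the countable ordinals `α < ω₁`. -/
abbrev Omega1 : Type := (ω₁ : Ordinal.{0}).ToType

/-- Jensen's principle `◇`: there are sets `A α ⊆ α` for `α < ω₁` such that for every `S ⊆ ω₁`
the set of all `α < ω₁` with `S ∩ α = A α` is stationary in `ω₁`
(here `α` is identified with the set `Set.Iio α` of its predecessors). -/
def JensenDiamond : Prop :=
  ∃ A : Omega1 → Set Omega1,
    (∀ α, A α ⊆ Set.Iio α) ∧
      ∀ S : Set Omega1, IsStationary {α : Omega1 | S ∩ Set.Iio α = A α}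

section BasicSequences

variable {X : Type*} [NormedAddCommGroup X] [NormedSpace ℝ X]

/-- The sum `∑_{α < ω₁} a α • y α`, for a finitely supported family `a` of reals. -/
noncomputable def fullSum (y : Omega1 → X) (a : Omega1 →₀ ℝ) : X :=
  ∑ α ∈ a.support, a α • y α

open Classical in
/-- The partial sum `∑_{α < l} a α • y α`, for a finitely supported family `a` of reals. -/
noncomputable def partialSum (y : Omega1 → X) (a : Omega1 →₀ ℝ) (l : Omega1) : X :=
  ∑ α ∈ a.support with α < l, a α • y α

/-- An uncountable `K`-basic sequence (of length `ω₁`) in a normed space: nonzero vectors `y α`,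
`α < ω₁`, such that initial partial sums are bounded by `K` times the norm of the full sum. -/
structure IsKBasicSeq (K : ℝ) (y : Omega1 → X) : Prop where
  ne_zero : ∀ α, y α ≠ 0
  norm_partialSum_le : ∀ (l : Omega1) (a : Omega1 →₀ ℝ), ‖partialSum y a l‖ ≤ K * ‖fullSum y a‖

/-- A `K`-basis of length `ω₁` of `X`: a `K`-basic sequence whose closed linear span is `X`. -/
structure IsKBasis (K : ℝ) (y : Omega1 → X) : Prop extends IsKBasicSeq K y where
  closure_span : closure (Submodule.span ℝ (Set.range y) : Set X) = Set.univ

end BasicSequences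

/-!
# A Banach space with a basis of length `ω₁` and optimal constant for uncountable basic sequences

The space is the completion of the finitely supported families `C00` under a seminorm `N` for which
the unit vectors are normalized and the initial projections have norm at most `K`; call such a
seminorm *good* if moreover all its restrictions to finitely many coordinates belong to a fixed
countable class of functions (`Good`, `Adm`).

*Transfer.* A map `t` of the indices extends to a linear map `T` of `C00`, and
`max (N (T x)) (sup_l N (T (P_l x)) / K)`, with `P_l` the initial projections, is again a good
seminorm (`Good.transfer`). It is the least one which makes `T` a contraction and respects the
constant `K`. Suppose that this seminorm coincides with `N` on the vectors in question, for maps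
that move a list `L` of indices to a list `w` further up. If this happens for lists
`p 0 < ... < p (m - 1) < q (m - 1) < ... < q 0`, with `p i` moved to `q i`, and if all the blocks
along these lists have norm `ζ`, then the sum of the blocks along the `p i` has norm at least
`m * ζ` (the `q i` in their turn are moved to one single list, for which the sum is `m` times one
block), while the difference of the sums along the `p i` and the `q i` has norm at most
`(m + K) * ζ / K`, because moving the last pair cancels it and only the initial projections, which
are divided by `K`, contribute (`Good.norm_sum_sub_le`, `Good.exists_blocks`). Cutting the
difference between the `p i` and the `q i` thus costs a factor close to `K`, and a `K'`-basic
sequence with `K' < K` whose differences are approximated by such blocks cannot exist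
(`not_isKBasicSeq`).

*Genericity.* The transfer relations are obtained by building `N` by recursion on `ω₁`. At each
coordinate `b`, countably many requirements are met by a generic one-step extension, a limit of
finite approximations (`exists_generic`): for each of countably many sets `A` of lists below `b`,
each finite list `e` up to `b` and each admissible `g`, either `N` induces `g` along `e ++ L` for
some `L ∈ A`, or a finite approximation prevents this. Together with the amalgamation of good
seminorms (`exists_good_amalgam`), induction on the largest coordinate involved shows that a set `A`
of lists below `d` contains, over any finite set of coordinates, a list that is related by transfer
to a given list `w` above `d`, as soon as it contains lists that look like `w` over each finite set
of coordinates below `d` (`Good.exists_agreeOn_transfer`).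

*Guessing.* The sets `A` are provided by `◇`. Given an uncountable basic sequence, approximation by
rational vectors and a pigeonhole argument produce an uncountable family of lists with one common
pattern of rational coefficients (`exists_uniform_differences`). The guess at `d` is the part of
this family below `d` for stationarily many `d`, and since there are only countably many admissible
functions, for a club of `d` the lists above `d` look, over each finite set of coordinates below
`d`, like lists of the family below `d` (`exists_reflection_bound`, `Good.exists_copyAt`).
-/

/-! ### The order `ω₁` -/

theorem mk_Omega1 : Cardinal.mk Omega1 = Cardinal.aleph 1 := by
  rw [Cardinal.mk_toType]; simp

instance : NoMaxOrder Omega1 := by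
  rw [← Ordinal.isSuccPrelimit_type_lt_iff, Ordinal.type_toType]
  exact (Cardinal.isSuccLimit_omega 1).isSuccPrelimit

instance : Infinite Omega1 := by
  rw [Cardinal.infinite_iff, mk_Omega1]; exact Cardinal.aleph0_le_aleph 1

theorem countable_Iio_Omega1 (a : Omega1) : (Set.Iio a).Countable := by
  have h : Cardinal.mk (Set.Iio a) < Cardinal.mk Omega1 :=
    Cardinal.mk_Iio_lt a (by rw [mk_Omega1, Ordinal.type_toType]; simp)
  rw [mk_Omega1, ← Cardinal.succ_aleph0, Order.lt_succ_iff] at h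
  exact Cardinal.le_aleph0_iff_set_countable.1 h

theorem countable_Iic_Omega1 (a : Omega1) : (Set.Iic a).Countable := by
  obtain ⟨b, hb⟩ := exists_gt a
  exact (countable_Iio_Omega1 b).mono fun x hx ↦ lt_of_le_of_lt hx hb

theorem exists_gt_of_countable {s : Set Omega1} (hs : s.Countable) : ∃ b, ∀ a ∈ s, a < b := by
  by_contra! h
  have hu : (Set.univ : Set Omega1).Countable := by
    refine (hs.biUnion fun a _ ↦ countable_Iic_Omega1 a).mono fun b _ ↦ ?_
    obtain ⟨a, ha, hab⟩ := h b
    exact Set.mem_biUnion ha hab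
  have h1 : Cardinal.mk Omega1 ≤ Cardinal.aleph0 := by
    rw [← Cardinal.mk_univ]; exact Cardinal.le_aleph0_iff_set_countable.2 hu
  rw [mk_Omega1, ← Cardinal.succ_aleph0] at h1
  exact absurd (Order.lt_succ Cardinal.aleph0) (not_lt.2 h1)

theorem exists_gt_range {ι : Type*} [Countable ι] (f : ι → Omega1) : ∃ b, ∀ i, f i < b := by
  obtain ⟨b, hb⟩ := exists_gt_of_countable (Set.countable_range f)
  exact ⟨b, fun i ↦ hb _ ⟨i, rfl⟩⟩

theorem exists_list_injection : ∃ f : List Omega1 → Omega1, Function.Injective f := by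
  have h : Cardinal.mk (List Omega1) = Cardinal.mk Omega1 := Cardinal.mk_list_eq_mk _
  obtain ⟨e⟩ := Cardinal.eq.1 h
  exact ⟨e, e.injective⟩

/-- The points above `c` that are closed under `f` form a club. -/
theorem isClub_closedUnder (f : Omega1 → Omega1) (c : Omega1) :
    IsClub {d : Omega1 | c < d ∧ ∀ x < d, f x < d} := by
  constructor
  · intro s hs hne _ a ha
    obtain ⟨y, hy⟩ := hne
    refine ⟨(hs hy).1.trans_le (ha.1 hy), fun x hx ↦ ?_⟩
    obtain ⟨z, hz, hxz⟩ := (lt_isLUB_iff ha).1 hx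
    exact ((hs hz).2 x hxz).trans_le (ha.1 hz)
  · intro b
    have hstep : ∀ y : Omega1, ∃ z, y < z ∧ ∀ x ≤ y, f x < z := by
      intro y
      obtain ⟨z, hz⟩ := exists_gt_of_countable (((countable_Iic_Omega1 y).image f).insert y)
      exact ⟨z, hz y (Set.mem_insert _ _), fun x hx ↦
        hz _ (Set.mem_insert_of_mem _ ⟨x, hx, rfl⟩)⟩
    choose g hg1 hg2 using hstep
    let u : ℕ → Omega1 := fun n ↦ g^[n] (max b c)
    have hu : ∀ n, u (n + 1) = g (u n) := fun n ↦ Function.iterate_succ_apply' g n _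
    have hne : {x | ∀ n, u n < x}.Nonempty := exists_gt_range u
    let d := wellFounded_lt.min {x | ∀ n, u n < x} hne
    have hd : ∀ n, u n < d := wellFounded_lt.min_mem _ hne
    have hbc : max b c < d := hd 0
    refine ⟨d, ⟨(le_max_right _ _).trans_lt hbc, fun x hx ↦ ?_⟩, (le_max_left _ _).trans hbc.le⟩
    have hx' : ¬ ∀ n, u n < x := fun h ↦ wellFounded_lt.not_lt_min (s := {x | ∀ n, u n < x}) h hx
    push Not at hx'
    obtain ⟨n, hn⟩ := hx'
    exact (hu n ▸ hg2 (u n) x hn).trans (hd (n + 1))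

/-- A function on a well-order is built by recursion from one-step extensions: if every partial
solution below `b` extends to `b`, then there is a global solution. -/
theorem exists_of_extension {ι β : Type*} [LinearOrder ι] [WellFoundedLT ι] [Nonempty β]
    (Q : ι → β → Prop) (R : ι → ι → β → β → Prop)
    (h : ∀ b (f : ι → β), (∀ c < b, Q c (f c) ∧ ∀ d < c, R d c (f d) (f c)) →
      ∃ x, Q b x ∧ ∀ c < b, R c b (f c) x) :
    ∃ f : ι → β, ∀ b, Q b (f b) ∧ ∀ c < b, R c b (f c) (f b) := by
  classical
  let step : ∀ b, (∀ c, c < b → β) → β := fun b g ↦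
    if hx : ∃ x, Q b x ∧ ∀ c (hc : c < b), R c b (g c hc) x then hx.choose
    else Classical.arbitrary β
  let f : ι → β := (wellFounded_lt (α := ι)).fix step
  have hf : ∀ b, f b = step b fun c _ ↦ f c := fun b ↦ WellFounded.fix_eq _ _ _
  refine ⟨f, fun b ↦ ?_⟩
  induction b using (wellFounded_lt (α := ι)).induction with
  | _ b ih =>
    have hx : ∃ x, Q b x ∧ ∀ c, c < b → R c b (f c) x := h b f ih
    have : f b = hx.choose := by
      rw [hf b]; exact dif_pos hx
    rw [this]
    exact hx.choose_spec

/-! ### Finitely supported vectors along lists of indices -/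

/-- The space of finitely supported real families on `ω₁`. -/
abbrev C00 : Type := Omega1 →₀ ℝ

open Classical in
/-- The coordinate projection of `C00` onto the vectors supported in `J`. -/
noncomputable def restr (J : Set Omega1) : C00 →ₗ[ℝ] C00 where
  toFun x := x.filter (· ∈ J)
  map_add' _ _ := Finsupp.filter_add
  map_smul' _ _ := Finsupp.filter_smul

/-- The initial projection onto the coordinates below `l`. -/
noncomputable abbrev initProj (l : Omega1) : C00 →ₗ[ℝ] C00 := restr (Set.Iio l)

open Classical in
theorem restr_apply (J : Set Omega1) (x : C00) (a : Omega1) :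
    restr J x a = if a ∈ J then x a else 0 := by
  simp [restr, Finsupp.filter_apply]

theorem restr_eq_self {J : Set Omega1} {x : C00} : restr J x = x ↔ ∀ a, a ∉ J → x a = 0 := by
  classical
  simp only [Finsupp.ext_iff, restr_apply]
  refine forall_congr' fun a ↦ ?_
  by_cases h : a ∈ J <;> simp [h, eq_comm]

theorem restr_restr (I J : Set Omega1) (x : C00) : restr I (restr J x) = restr (I ∩ J) x := by
  classical
  ext a
  by_cases h : a ∈ I <;> by_cases h' : a ∈ J <;> simp [restr_apply, h, h']

theorem restr_comm (I J : Set Omega1) (x : C00) : restr I (restr J x) = restr J (restr I x) := by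
  rw [restr_restr, restr_restr, Set.inter_comm]

theorem restr_add_compl (J : Set Omega1) (x : C00) : restr J x + restr Jᶜ x = x := by
  classical
  ext a
  by_cases h : a ∈ J <;> simp [restr_apply, h]

theorem restr_restr_of_subset {I J : Set Omega1} (h : I ⊆ J) (x : C00) :
    restr J (restr I x) = restr I x := by
  rw [restr_restr, Set.inter_eq_right.2 h]

theorem restr_idem (J : Set Omega1) (x : C00) : restr J (restr J x) = restr J x :=
  restr_restr_of_subset subset_rfl x

theorem restr_mono_self {I J : Set Omega1} (h : I ⊆ J) {x : C00} (hx : restr I x = x) :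
    restr J x = x := by
  rw [← hx, restr_restr_of_subset h]

theorem restr_eq_zero {J : Set Omega1} {x : C00} : restr J x = 0 ↔ ∀ a ∈ J, x a = 0 := by
  classical
  simp only [Finsupp.ext_iff, restr_apply]
  refine forall_congr' fun a ↦ ?_
  by_cases h : a ∈ J <;> simp [h]

theorem restr_single (J : Set Omega1) (a : Omega1) (t : ℝ) [Decidable (a ∈ J)] :
    restr J (Finsupp.single a t) = if a ∈ J then Finsupp.single a t else 0 := by
  split_ifs with h
  · refine restr_eq_self.2 fun b hb ↦ Finsupp.single_eq_of_ne ?_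
    rintro rfl; exact hb h
  · refine restr_eq_zero.2 fun b hb ↦ Finsupp.single_eq_of_ne ?_
    rintro rfl; exact h hb

/-- The combination `∑ i, c i • e (L i)` of unit vectors along the list `L`; the coefficients
`c i` with `i ≥ L.length` are ignored. -/
noncomputable def vec : List Omega1 → (ℕ → ℝ) → C00
  | [], _ => 0
  | a :: L, c => Finsupp.single a (c 0) + vec L fun i ↦ c (i + 1)

theorem vec_append (L M : List Omega1) (c : ℕ → ℝ) :
    vec (L ++ M) c = vec L c + vec M fun i ↦ c (i + L.length) := by
  induction L generalizing c with
  | nil => simp [vec]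
  | cons a L ih => simp [vec, ih, add_assoc]

theorem vec_congr {L : List Omega1} {c d : ℕ → ℝ} (h : ∀ i < L.length, c i = d i) :
    vec L c = vec L d := by
  induction L generalizing c d with
  | nil => rfl
  | cons a L ih =>
    rw [vec, vec, h 0 (by simp), ih fun i hi ↦ h (i + 1) (by simpa using hi)]

theorem vec_zero (L : List Omega1) : vec L 0 = 0 := by
  induction L with
  | nil => rfl
  | cons a L ih =>
    have : (fun i ↦ (0 : ℕ → ℝ) (i + 1)) = 0 := rfl
    rw [vec, this, ih]; simp

theorem lmapDomain_vec (t : Omega1 → Omega1) (L : List Omega1) (c : ℕ → ℝ) :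
    Finsupp.lmapDomain ℝ ℝ t (vec L c) = vec (L.map t) c := by
  induction L generalizing c with
  | nil => simp [vec]
  | cons a L ih =>
    rw [vec, map_add, ih, List.map_cons, vec]
    simp

theorem vec_apply_of_notMem {L : List Omega1} {a : Omega1} (h : a ∉ L) (c : ℕ → ℝ) :
    vec L c a = 0 := by
  induction L generalizing c with
  | nil => rfl
  | cons b L ih =>
    rw [List.mem_cons, not_or] at h
    rw [vec, Finsupp.add_apply, ih h.2, Finsupp.single_eq_of_ne h.1, add_zero]

theorem restr_vec {J : Set Omega1} {L : List Omega1} (h : ∀ a ∈ L, a ∈ J) (c : ℕ → ℝ) :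
    restr J (vec L c) = vec L c :=
  restr_eq_self.2 fun _ ha ↦ vec_apply_of_notMem (fun h' ↦ ha (h _ h')) c

theorem restr_vec_eq_zero {J : Set Omega1} {L : List Omega1} (h : ∀ a ∈ L, a ∉ J) (c : ℕ → ℝ) :
    restr J (vec L c) = 0 :=
  restr_eq_zero.2 fun _ ha ↦ vec_apply_of_notMem (fun h' ↦ h _ h' ha) c

theorem initProj_vec_of_lt {l : Omega1} {L : List Omega1} (h : ∀ a ∈ L, a < l) (c : ℕ → ℝ) :
    initProj l (vec L c) = vec L c :=
  restr_vec (J := Set.Iio l) h c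

theorem initProj_vec_of_le {l : Omega1} {L : List Omega1} (h : ∀ a ∈ L, l ≤ a) (c : ℕ → ℝ) :
    initProj l (vec L c) = 0 :=
  restr_vec_eq_zero (J := Set.Iio l) (fun a ha ↦ not_lt.2 (h a ha)) c

theorem exists_eq_vec {L : List Omega1} {x : C00} (h : ∀ a, a ∉ L → x a = 0) :
    ∃ c, x = vec L c := by
  induction L generalizing x with
  | nil => exact ⟨0, by ext a; simpa [vec] using h a (by simp)⟩
  | cons b L ih =>
    obtain ⟨c, hc⟩ := ih (x := x - Finsupp.single b (x b)) fun a ha ↦ by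
      by_cases hab : a = b
      · subst hab; simp
      · rw [Finsupp.sub_apply, h a (by simp [hab, ha]), Finsupp.single_eq_of_ne hab, sub_zero]
    refine ⟨fun i ↦ Nat.casesOn i (x b) c, ?_⟩
    simp only [vec]
    rw [← hc]
    exact (add_sub_cancel (Finsupp.single b (x b)) x).symm

/-- The coefficient family that agrees with `c` on `S` and vanishes elsewhere. -/
def mask (S : Finset ℕ) (c : ℕ → ℝ) : ℕ → ℝ := fun i ↦ if i ∈ S then c i else 0

theorem exists_restr_vec_eq (J : Set Omega1) (L : List Omega1) :
    ∃ S ⊆ Finset.range L.length, ∀ c, restr J (vec L c) = vec L (mask S c) := by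
  classical
  induction L with
  | nil => exact ⟨∅, by simp, fun c ↦ by simp [vec]⟩
  | cons a L ih =>
    obtain ⟨S, hS, h⟩ := ih
    have key : ∀ S' : Finset ℕ, (∀ i, i + 1 ∈ S' ↔ i ∈ S) → ∀ c,
        (fun i ↦ mask S' c (i + 1)) = mask S fun i ↦ c (i + 1) := by
      intro S' hS' c
      ext i
      simp [mask, hS']
    by_cases ha : a ∈ J
    · refine ⟨insert 0 (S.image (· + 1)), ?_, fun c ↦ ?_⟩
      · intro i hi
        simp only [Finset.mem_insert, Finset.mem_image] at hi
        rcases hi with rfl | ⟨j, hj, rfl⟩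
        · simp
        · simpa using hS hj
      · rw [vec, map_add, h, vec, restr_single, if_pos ha, key _ (by simp)]
        simp [mask]
    · refine ⟨S.image (· + 1), ?_, fun c ↦ ?_⟩
      · intro i hi
        simp only [Finset.mem_image] at hi
        obtain ⟨j, hj, rfl⟩ := hi
        simpa using hS hj
      · rw [vec, map_add, h, vec, restr_single, if_neg ha, key _ (by simp)]
        simp [mask]

theorem exists_vec_apply_eq (a : Omega1) (L : List Omega1) :
    ∃ S : Finset ℕ, ∀ c, vec L c a = ∑ i ∈ S, c i := by
  classical
  induction L with
  | nil => exact ⟨∅, fun c ↦ by simp [vec]⟩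
  | cons b L ih =>
    obtain ⟨S, h⟩ := ih
    by_cases hb : b = a
    · refine ⟨insert 0 (S.map (addRightEmbedding 1)), fun c ↦ ?_⟩
      rw [Finset.sum_insert (by simp), Finset.sum_map, vec, Finsupp.add_apply, h]
      simp [hb]
    · refine ⟨S.map (addRightEmbedding 1), fun c ↦ ?_⟩
      rw [Finset.sum_map, vec, Finsupp.add_apply, h, Finsupp.single_eq_of_ne (Ne.symm hb)]
      simp

/-! ### A countable class of admissible functions -/

/-- Codes for the admissible functions of real variables indexed by `ℕ`. The operations are those
under which the restrictions of the seminorms of the construction to finitely many coordinates have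
to be closed: `absSum` for the `ℓ₁` norm, `restrict` for coordinate projections, `add` for
`ℓ₁`-sums, `sup` and `scale` (multiplication by `K⁻¹`) for transfer, and `infProj` for
amalgamation. -/
inductive AdmCode : Type
  | absSum (S : Finset ℕ)
  | restrict (S : Finset ℕ) (h : AdmCode)
  | add (h h' : AdmCode)
  | sup (h h' : AdmCode)
  | scale (h : AdmCode)
  | infProj (n : ℕ) (h : AdmCode)
  deriving Countable

/-- The function of infinitely many formal variables coded by an `AdmCode`. The code `infProj n h`
keeps the variables with index below `n` and minimizes over the remaining ones. For `0 ≤ K` all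
these functions are nonnegative, so that the infimum is a genuine one. -/
noncomputable def AdmCode.eval (K : ℝ) : AdmCode → (ℕ → ℝ) → ℝ
  | absSum S, c => |∑ i ∈ S, c i|
  | restrict S h, c => h.eval K (mask S c)
  | add h h', c => h.eval K c + h'.eval K c
  | sup h h', c => max (h.eval K c) (h'.eval K c)
  | scale h, c => K⁻¹ * h.eval K c
  | infProj n h, c => ⨅ d : ℕ → ℝ, h.eval K fun i ↦ if i < n then c i else d i

/-- The countable class of admissible functions: the functions that have a code. It contains all
finite-dimensional restrictions of the seminorms that occur in the construction. -/
def Adm (K : ℝ) : Set ((ℕ → ℝ) → ℝ) := Set.range (AdmCode.eval K)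

namespace Adm

variable {K : ℝ} {g h : (ℕ → ℝ) → ℝ}

theorem countable (K : ℝ) : (Adm K).Countable := Set.countable_range _

theorem absSum (K : ℝ) (S : Finset ℕ) : (fun c : ℕ → ℝ ↦ |∑ i ∈ S, c i|) ∈ Adm K :=
  ⟨.absSum S, rfl⟩

theorem zero (K : ℝ) : (fun _ : ℕ → ℝ ↦ (0 : ℝ)) ∈ Adm K := by
  simpa using absSum K ∅

theorem restrict (hg : g ∈ Adm K) (S : Finset ℕ) : (fun c ↦ g (mask S c)) ∈ Adm K := by
  obtain ⟨a, rfl⟩ := hg; exact ⟨.restrict S a, rfl⟩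

theorem add (hg : g ∈ Adm K) (hh : h ∈ Adm K) : (fun c ↦ g c + h c) ∈ Adm K := by
  obtain ⟨a, rfl⟩ := hg; obtain ⟨b, rfl⟩ := hh; exact ⟨.add a b, rfl⟩

theorem sup (hg : g ∈ Adm K) (hh : h ∈ Adm K) : (fun c ↦ max (g c) (h c)) ∈ Adm K := by
  obtain ⟨a, rfl⟩ := hg; obtain ⟨b, rfl⟩ := hh; exact ⟨.sup a b, rfl⟩

theorem scale (hg : g ∈ Adm K) : (fun c ↦ K⁻¹ * g c) ∈ Adm K := by
  obtain ⟨a, rfl⟩ := hg; exact ⟨.scale a, rfl⟩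

theorem infProj (hg : g ∈ Adm K) (n : ℕ) :
    (fun c ↦ ⨅ d : ℕ → ℝ, g fun i ↦ if i < n then c i else d i) ∈ Adm K := by
  obtain ⟨a, rfl⟩ := hg; exact ⟨.infProj n a, rfl⟩

theorem sum {ι : Type*} (s : Finset ι) (f : ι → (ℕ → ℝ) → ℝ) (hf : ∀ i ∈ s, f i ∈ Adm K) :
    (fun c ↦ ∑ i ∈ s, f i c) ∈ Adm K := by
  classical
  induction s using Finset.induction_on with
  | empty => simpa using zero K
  | insert a s ha ih =>
    simp only [Finset.sum_insert ha]
    exact add (hf a (by simp)) (ih fun i hi ↦ hf i (by simp [hi]))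

/-- The class is closed under pointwise suprema of families with finitely many members. -/
theorem iSup {ι : Type*} [Nonempty ι] (f : ι → (ℕ → ℝ) → ℝ) (hf : ∀ i, f i ∈ Adm K)
    (hfin : (Set.range f).Finite) : (fun c ↦ ⨆ i, f i c) ∈ Adm K := by
  have main : ∀ s : Set ((ℕ → ℝ) → ℝ), s.Finite → s.Nonempty → s ⊆ Adm K →
      (fun c ↦ sSup ((fun g : (ℕ → ℝ) → ℝ ↦ g c) '' s)) ∈ Adm K := by
    intro s hs
    induction s, hs using Set.Finite.induction_on with
    | empty => intro h; exact absurd h (by simp)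
    | @insert g s hg hs ih =>
      intro _ hsub
      rcases s.eq_empty_or_nonempty with rfl | hne
      · simpa using hsub (by simp : g ∈ insert g ∅)
      · have h1 := ih hne ((Set.subset_insert _ _).trans hsub)
        have h2 := sup (hsub (Set.mem_insert _ _)) h1
        convert h2 using 2 with c
        rw [Set.image_insert_eq, csSup_insert (hs.image _).bddAbove (hne.image _)]
  have h := main _ hfin (Set.range_nonempty f) (by rintro _ ⟨i, rfl⟩; exact hf i)
  convert h using 2 with c
  rw [← Set.range_comp]
  rfl

end Adm

/-! ### Good seminorms -/

/-- The function of the coefficients that a seminorm induces along a list of indices. -/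
noncomputable def tp (N : Seminorm ℝ C00) (L : List Omega1) : (ℕ → ℝ) → ℝ := fun c ↦ N (vec L c)

/-- A seminorm on `C00` is good if the unit vectors form a normalized system whose initial
projections have norm at most `K`, and if all its restrictions to finitely many coordinates are
admissible. -/
structure Good (K : ℝ) (N : Seminorm ℝ C00) : Prop where
  initProj_le : ∀ l x, N (initProj l x) ≤ K * N x
  single : ∀ a, N (Finsupp.single a 1) = 1
  tp_mem : ∀ L, tp N L ∈ Adm K

/-- The `ℓ₁` norm on `C00`. -/
noncomputable def ell1 : Seminorm ℝ C00 :=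
  Seminorm.of (fun x ↦ ∑ a ∈ x.support, |x a|)
    (fun x y ↦ by
      classical
      have h : ∀ z : C00, z.support ⊆ x.support ∪ y.support →
          ∑ a ∈ z.support, |z a| = ∑ a ∈ x.support ∪ y.support, |z a| := fun z hz ↦
        Finset.sum_subset hz fun a _ ha ↦ by simpa using ha
      rw [h _ Finsupp.support_add, h x Finset.subset_union_left, h y Finset.subset_union_right,
        ← Finset.sum_add_distrib]
      exact Finset.sum_le_sum fun a _ ↦ abs_add_le _ _)
    (fun t x ↦ by
      rcases eq_or_ne t 0 with rfl | ht
      · simp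
      · rw [Finsupp.support_smul_eq ht, Finset.mul_sum]
        simp [abs_mul])

theorem ell1_eq_sum {x : C00} {s : Finset Omega1} (h : ∀ a, a ∉ s → x a = 0) :
    ell1 x = ∑ a ∈ s, |x a| := by
  refine Finset.sum_subset (fun a ha ↦ ?_) fun a _ ha ↦ by simpa using ha
  by_contra h'
  exact (Finsupp.mem_support_iff.1 ha) (h a h')

theorem ell1_restr_le (J : Set Omega1) (x : C00) : ell1 (restr J x) ≤ ell1 x := by
  classical
  rw [ell1_eq_sum (s := x.support) (x := x) (by simp),
    ell1_eq_sum (s := x.support) (x := restr J x) (fun a ha ↦ by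
      rw [restr_apply]; simp at ha; simp [ha])]
  refine Finset.sum_le_sum fun a _ ↦ ?_
  rw [restr_apply]; split_ifs <;> simp

theorem abs_apply_le_ell1 (x : C00) (a : Omega1) : |x a| ≤ ell1 x := by
  classical
  rw [ell1_eq_sum (s := insert a x.support) (x := x) (by simp)]
  exact Finset.single_le_sum (f := fun a ↦ |x a|) (fun _ _ ↦ abs_nonneg _) (by simp)

theorem ell1_single (a : Omega1) (t : ℝ) : ell1 (Finsupp.single a t) = |t| := by
  rw [ell1_eq_sum (s := {a}) (fun b hb ↦ Finsupp.single_eq_of_ne (by simpa using hb))]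
  simp

theorem tp_ell1_mem (K : ℝ) (L : List Omega1) : tp ell1 L ∈ Adm K := by
  classical
  have h : tp ell1 L = fun c ↦ ∑ a ∈ L.toFinset, |vec L c a| := by
    ext c
    exact ell1_eq_sum fun a ha ↦ vec_apply_of_notMem (by simpa using ha) c
  rw [h]
  refine Adm.sum _ (fun a c ↦ |vec L c a|) fun a _ ↦ ?_
  obtain ⟨S, hS⟩ := exists_vec_apply_eq a L
  simp only [hS]
  exact Adm.absSum K S

theorem ell1_good {K : ℝ} (hK : 1 ≤ K) : Good K ell1 where
  initProj_le _ x := (ell1_restr_le _ x).trans (le_mul_of_one_le_left (apply_nonneg _ _) hK)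
  single a := by rw [ell1_single, abs_one]
  tp_mem := tp_ell1_mem K

theorem tp_restr_mem {K : ℝ} {N : Seminorm ℝ C00} {L : List Omega1} (h : tp N L ∈ Adm K)
    (J : Set Omega1) : (fun c ↦ N (restr J (vec L c))) ∈ Adm K := by
  obtain ⟨S, -, hS⟩ := exists_restr_vec_eq J L
  simp only [hS]
  exact Adm.restrict h S

theorem seminorm_le_ell1 {N : Seminorm ℝ C00} (h : ∀ a, N (Finsupp.single a 1) ≤ 1) (x : C00) :
    N x ≤ ell1 x := by
  classical
  conv_lhs => rw [← Finsupp.sum_single x]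
  refine (Finset.le_sum_of_subadditive N (map_zero N).le (map_add_le_add N) _ _).trans ?_
  refine Finset.sum_le_sum fun a _ ↦ ?_
  rw [← mul_one (x a), ← smul_eq_mul, ← Finsupp.smul_single, map_smul_eq_mul, smul_eq_mul, mul_one]
  exact mul_le_of_le_one_right (norm_nonneg _) (h a)

theorem Good.le_ell1 {K : ℝ} {N : Seminorm ℝ C00} (h : Good K N) (x : C00) : N x ≤ ell1 x :=
  seminorm_le_ell1 (fun a ↦ (h.single a).le) x

/-- The seminorm that agrees with `N` on the vectors supported in `J` and is extended to the
remaining coordinates as an `ℓ₁`-sum. -/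
noncomputable def freeze (J : Set Omega1) (N : Seminorm ℝ C00) : Seminorm ℝ C00 :=
  N.comp (restr J) + ell1.comp (restr Jᶜ)

theorem freeze_apply (J : Set Omega1) (N : Seminorm ℝ C00) (x : C00) :
    freeze J N x = N (restr J x) + ell1 (restr Jᶜ x) := rfl

theorem freeze_of_restr_eq {J : Set Omega1} (N : Seminorm ℝ C00) {x : C00} (h : restr J x = x) :
    freeze J N x = N x := by
  have h0 : restr Jᶜ x = 0 := restr_eq_zero.2 fun a ha ↦ restr_eq_self.1 h a ha
  rw [freeze_apply, h, h0, map_zero, add_zero]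

theorem freeze_single_of_notMem {J : Set Omega1} (N : Seminorm ℝ C00) {a : Omega1} (h : a ∉ J) :
    freeze J N (Finsupp.single a 1) = 1 := by
  classical
  have h' : a ∈ Jᶜ := h
  rw [freeze_apply, restr_single, restr_single, if_neg h, if_pos h', map_zero, ell1_single]
  simp

theorem Good.freeze {K : ℝ} (hK : 1 ≤ K) {N : Seminorm ℝ C00} (h : Good K N) (J : Set Omega1) :
    Good K (freeze J N) where
  initProj_le l x := by
    rw [freeze_apply, freeze_apply, restr_comm J, restr_comm Jᶜ, mul_add]
    exact add_le_add (h.initProj_le _ _) ((ell1_good hK).initProj_le _ _)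
  single a := by
    classical
    by_cases ha : a ∈ J
    · rw [freeze_of_restr_eq _ (by rw [restr_single, if_pos ha]), h.single]
    · exact freeze_single_of_notMem N ha
  tp_mem L := Adm.add (tp_restr_mem (h.tp_mem L) J) (tp_restr_mem (tp_ell1_mem K L) Jᶜ)

/-- Two seminorms agree on the vectors supported in `J`. -/
def AgreeOn (J : Set Omega1) (N M : Seminorm ℝ C00) : Prop := ∀ x, restr J x = x → N x = M x

theorem AgreeOn.symm {J : Set Omega1} {N M : Seminorm ℝ C00} (h : AgreeOn J N M) :
    AgreeOn J M N := fun x hx ↦ (h x hx).symm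

theorem AgreeOn.trans {J : Set Omega1} {N M Q : Seminorm ℝ C00} (h : AgreeOn J N M)
    (h' : AgreeOn J M Q) : AgreeOn J N Q := fun x hx ↦ (h x hx).trans (h' x hx)

theorem AgreeOn.mono {I J : Set Omega1} (hIJ : I ⊆ J) {N M : Seminorm ℝ C00}
    (h : AgreeOn J N M) : AgreeOn I N M := fun x hx ↦ h x (restr_mono_self hIJ hx)

theorem AgreeOn.tp_eq {J : Set Omega1} {N M : Seminorm ℝ C00} (h : AgreeOn J N M)
    {L : List Omega1} (hL : ∀ a ∈ L, a ∈ J) : tp N L = tp M L :=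
  funext fun c ↦ h _ (restr_vec hL c)

theorem agreeOn_of_tp_eq {J : Set Omega1} {N M : Seminorm ℝ C00} {L : List Omega1}
    (hL : ∀ a ∈ J, a ∈ L) (h : tp N L = tp M L) : AgreeOn J N M := by
  intro x hx
  obtain ⟨c, rfl⟩ := exists_eq_vec (L := L) (x := x) fun a ha ↦
    restr_eq_self.1 hx a fun h' ↦ ha (hL a h')
  exact congrFun h c

/-- Directed families of good seminorms that agree on increasing sets of coordinates have a good
limit. -/
theorem exists_good_limit {K : ℝ} (hK : 1 ≤ K) {ι : Type*} [LinearOrder ι]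
    (S : ι → Set Omega1) (q : ι → Seminorm ℝ C00) (hS : Monotone S) (hq : ∀ i, Good K (q i))
    (hag : ∀ i j, i ≤ j → AgreeOn (S i) (q j) (q i)) :
    ∃ N, Good K N ∧ ∀ i, AgreeOn (S i) N (q i) := by
  classical
  rcases isEmpty_or_nonempty ι with hι | hι
  · exact ⟨ell1, ell1_good hK, fun i ↦ isEmptyElim i⟩
  set J : Set Omega1 := ⋃ i, S i with hJ
  -- every finite subset of the union lies in one of the sets
  have hfin : ∀ s : Finset Omega1, (∀ a ∈ s, a ∈ J) → ∃ i, ∀ a ∈ s, a ∈ S i := by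
    intro s
    induction s using Finset.induction_on with
    | empty => intro _; exact ⟨Classical.arbitrary ι, by simp⟩
    | insert a s _ ih =>
      intro h
      obtain ⟨i, hi⟩ := ih fun b hb ↦ h b (by simp [hb])
      obtain ⟨j, hj⟩ := Set.mem_iUnion.1 (h a (by simp))
      refine ⟨max i j, fun b hb ↦ ?_⟩
      rcases Finset.mem_insert.1 hb with rfl | hb
      · exact hS (le_max_right i j) hj
      · exact hS (le_max_left i j) (hi b hb)
  have hx : ∀ x : C00, ∃ i, restr (S i) (restr J x) = restr J x := by
    intro x
    obtain ⟨i, hi⟩ := hfin (restr J x).support fun a ha ↦ by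
      by_contra h
      exact Finsupp.mem_support_iff.1 ha (by rw [restr_apply, if_neg h])
    refine ⟨i, restr_eq_self.2 fun a ha ↦ ?_⟩
    by_contra h
    exact ha (hi a (Finsupp.mem_support_iff.2 h))
  choose u hu using hx
  have hval : ∀ x i, restr (S i) (restr J x) = restr J x →
      q (u x) (restr J x) = q i (restr J x) := by
    intro x i hi
    rcases le_total i (u x) with h | h
    · exact hag _ _ h _ hi
    · exact (hag _ _ h _ (hu x)).symm
  let p : Seminorm ℝ C00 := Seminorm.of (fun x ↦ q (u x) (restr J x))
    (fun x y ↦ by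
      set i := max (u x) (u y)
      have h1 := restr_mono_self (hS (le_max_left (u x) (u y))) (hu x)
      have h2 := restr_mono_self (hS (le_max_right (u x) (u y))) (hu y)
      rw [hval x i h1, hval y i h2, hval (x + y) i (by rw [map_add, map_add, h1, h2]), map_add]
      exact map_add_le_add _ _ _)
    (fun t x ↦ by
      rw [hval (t • x) (u x) (by rw [map_smul, map_smul, hu x]), map_smul, map_smul_eq_mul])
  have hp : ∀ x i, restr (S i) (restr J x) = restr J x → p x = q i (restr J x) := hval
  have hpJ : ∀ i x, restr (S i) x = x → p x = q i x := by
    intro i x h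
    have hJx : restr J x = x := restr_mono_self (Set.subset_iUnion S i) h
    rw [hp x i (by rw [hJx, h]), hJx]
  have hpgood : ∀ L : List Omega1, (fun c ↦ p (restr J (vec L c))) ∈ Adm K := by
    intro L
    obtain ⟨i, hi⟩ := hfin (L.toFinset.filter (· ∈ J)) (by simp)
    have hrw : (fun c ↦ p (restr J (vec L c))) = fun c ↦ q i (restr J (vec L c)) := by
      ext c
      refine hpJ i _ (restr_eq_self.2 fun a ha ↦ ?_)
      rw [restr_apply]
      split_ifs with haJ
      · exact vec_apply_of_notMem (fun haL ↦ ha (hi a (by simp [haL, haJ]))) c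
      · rfl
    rw [hrw]
    exact tp_restr_mem ((hq i).tp_mem L) J
  refine ⟨freeze J p, ⟨fun l x ↦ ?_, fun a ↦ ?_, fun L ↦ ?_⟩, fun i x h ↦ ?_⟩
  · rw [freeze_apply, freeze_apply, restr_comm J, restr_comm Jᶜ, mul_add]
    refine add_le_add ?_ ((ell1_good hK).initProj_le _ _)
    have h1 := hu x
    rw [hpJ (u x) (restr J x) h1, hpJ (u x) (initProj l (restr J x)) (by rw [restr_comm, h1])]
    exact (hq _).initProj_le _ _
  · by_cases ha : a ∈ J
    · have hs : restr J (Finsupp.single a (1 : ℝ)) = Finsupp.single a 1 := by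
        rw [restr_single, if_pos ha]
      rw [freeze_of_restr_eq _ hs, hp _ _ (hu _), hs, (hq _).single]
    · exact freeze_single_of_notMem p ha
  · exact Adm.add (hpgood L) (tp_restr_mem (tp_ell1_mem K L) Jᶜ)
  · rw [freeze_of_restr_eq _ (restr_mono_self (Set.subset_iUnion S i) h)]
    exact hpJ i x h

/-! ### Transfer along a map of the indices -/

/-- The seminorm `max (N (T x)) (sup_l N (T (P_l x)) / K)`, where `T` is the linear extension of
the map `t` of the indices and `P_l` are the initial projections. -/
noncomputable def transferSeminorm (K : ℝ) (t : Omega1 → Omega1) (N : Seminorm ℝ C00) :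
    Seminorm ℝ C00 :=
  N.comp (Finsupp.lmapDomain ℝ ℝ t) ⊔
    K.toNNReal⁻¹ • ⨆ l, N.comp (Finsupp.lmapDomain ℝ ℝ t ∘ₗ initProj l)

theorem ell1_lmapDomain_le (t : Omega1 → Omega1) (x : C00) :
    ell1 (Finsupp.lmapDomain ℝ ℝ t x) ≤ ell1 x :=
  seminorm_le_ell1 (N := ell1.comp (Finsupp.lmapDomain ℝ ℝ t)) (fun a ↦ by
    rw [Seminorm.comp_apply, Finsupp.lmapDomain_apply, Finsupp.mapDomain_single, ell1_single,
      abs_one]) x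

section Transfer

variable {K : ℝ} {N : Seminorm ℝ C00}

theorem Good.bddAbove_transfer (h : Good K N) (t : Omega1 → Omega1) (x : C00) :
    BddAbove (Set.range fun l ↦ N (Finsupp.lmapDomain ℝ ℝ t (initProj l x))) := by
  refine ⟨ell1 x, ?_⟩
  rintro _ ⟨l, rfl⟩
  exact ((h.le_ell1 _).trans (ell1_lmapDomain_le t _)).trans (ell1_restr_le _ x)

theorem Good.transfer_apply (hK : 1 ≤ K) (h : Good K N) (t : Omega1 → Omega1) (x : C00) :
    transferSeminorm K t N x = max (N (Finsupp.lmapDomain ℝ ℝ t x))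
      (K⁻¹ * ⨆ l, N (Finsupp.lmapDomain ℝ ℝ t (initProj l x))) := by
  have hb : BddAbove (Set.range fun l ↦ N.comp (Finsupp.lmapDomain ℝ ℝ t ∘ₗ initProj l)) :=
    Seminorm.bddAbove_range_iff.2 fun x ↦ h.bddAbove_transfer t x
  rw [transferSeminorm, Seminorm.sup_apply, _root_.smul_apply, Seminorm.iSup_apply hb,
    NNReal.smul_def, NNReal.coe_inv, Real.coe_toNNReal _ (by linarith)]
  rfl

theorem Good.le_transfer (hK : 1 ≤ K) (h : Good K N) (t : Omega1 → Omega1) (x : C00) :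
    N (Finsupp.lmapDomain ℝ ℝ t x) ≤ transferSeminorm K t N x := by
  rw [h.transfer_apply hK]; exact le_max_left _ _

theorem Good.initProj_le_transfer (hK : 1 ≤ K) (h : Good K N) (t : Omega1 → Omega1) (x : C00)
    (l : Omega1) : N (Finsupp.lmapDomain ℝ ℝ t (initProj l x)) ≤ K * transferSeminorm K t N x := by
  have hK0 : 0 < K := by linarith
  rw [← inv_mul_le_iff₀ hK0, h.transfer_apply hK]
  refine le_trans ?_ (le_max_right _ _)
  exact mul_le_mul_of_nonneg_left (le_ciSup (h.bddAbove_transfer t x) l) (by positivity)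

theorem Good.transfer_le (hK : 1 ≤ K) (h : Good K N) {t : Omega1 → Omega1} {x : C00} {B : ℝ}
    (h1 : N (Finsupp.lmapDomain ℝ ℝ t x) ≤ B)
    (h2 : ∀ l, N (Finsupp.lmapDomain ℝ ℝ t (initProj l x)) ≤ K * B) :
    transferSeminorm K t N x ≤ B := by
  have hK0 : 0 < K := by linarith
  rw [h.transfer_apply hK]
  refine max_le h1 ?_
  rw [inv_mul_le_iff₀ hK0]
  exact ciSup_le h2

theorem initProj_initProj (l m : Omega1) (x : C00) :
    initProj l (initProj m x) = initProj (min l m) x := by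
  rw [restr_restr, Set.Iio_inter_Iio]

theorem Good.transfer (hK : 1 ≤ K) (h : Good K N) (t : Omega1 → Omega1) :
    Good K (transferSeminorm K t N) where
  initProj_le l x := by
    refine h.transfer_le hK (h.initProj_le_transfer hK t x l) fun m ↦ ?_
    rw [initProj_initProj]
    refine (h.initProj_le_transfer hK t x _).trans ?_
    exact mul_le_mul_of_nonneg_left (le_mul_of_one_le_left (apply_nonneg _ _) hK)
      (zero_le_one.trans hK)
  single a := by
    classical
    refine le_antisymm (h.transfer_le hK ?_ fun l ↦ ?_) ?_
    · rw [Finsupp.lmapDomain_apply, Finsupp.mapDomain_single, h.single]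
    · rw [restr_single]
      split_ifs
      · rw [Finsupp.lmapDomain_apply, Finsupp.mapDomain_single, h.single]; linarith
      · rw [map_zero, map_zero]; linarith
    · refine le_trans ?_ (h.le_transfer hK t _)
      rw [Finsupp.lmapDomain_apply, Finsupp.mapDomain_single, h.single]
  tp_mem L := by
    have heq : tp (transferSeminorm K t N) L = fun c ↦ max (tp N (L.map t) c)
        (K⁻¹ * ⨆ l, N (Finsupp.lmapDomain ℝ ℝ t (initProj l (vec L c)))) := by
      ext c
      rw [tp, h.transfer_apply hK, lmapDomain_vec]; rfl
    rw [heq]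
    refine Adm.sup (h.tp_mem _) (Adm.scale ?_)
    choose S hS hS' using fun l ↦ exists_restr_vec_eq (Set.Iio l) L
    simp only [hS', lmapDomain_vec]
    refine Adm.iSup (fun l c ↦ N (vec (L.map t) (mask (S l) c)))
      (fun l ↦ Adm.restrict (h.tp_mem (L.map t)) (S l)) ?_
    refine Set.Finite.subset (Set.Finite.image (fun (s : Finset ℕ) c ↦ N (vec (L.map t) (mask s c)))
      (Finset.range L.length).powerset.finite_toSet) ?_
    rintro _ ⟨l, rfl⟩
    exact ⟨S l, Finset.mem_coe.2 (Finset.mem_powerset.2 (hS l)), rfl⟩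

theorem lmapDomain_eq_self {t : Omega1 → Omega1} {J : Set Omega1} (ht : ∀ a ∈ J, t a = a)
    {x : C00} (hx : restr J x = x) : Finsupp.lmapDomain ℝ ℝ t x = x := by
  rw [Finsupp.lmapDomain_apply]
  conv_rhs => rw [← Finsupp.mapDomain_id (v := x)]
  refine Finsupp.mapDomain_congr fun a ha ↦ ?_
  by_contra h
  exact Finsupp.mem_support_iff.1 ha (restr_eq_self.1 hx a fun h' ↦ h (ht a h'))

theorem Good.transfer_agreeOn (hK : 1 ≤ K) (h : Good K N) {t : Omega1 → Omega1} {J : Set Omega1}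
    (ht : ∀ a ∈ J, t a = a) : AgreeOn J (transferSeminorm K t N) N := by
  intro x hx
  refine le_antisymm (h.transfer_le hK (by rw [lmapDomain_eq_self ht hx]) fun l ↦ ?_) ?_
  · rw [lmapDomain_eq_self ht (by rw [restr_comm, hx])]
    exact h.initProj_le l x
  · conv_lhs => rw [← lmapDomain_eq_self ht hx]
    exact h.le_transfer hK t x

end Transfer

/-! ### Amalgamation -/

theorem inf_apply_le (M p : Seminorm ℝ C00) (x u : C00) : (M ⊓ p) x ≤ M u + p (x - u) := by
  rw [Seminorm.inf_apply]
  exact ciInf_le ⟨0, by rintro _ ⟨v, rfl⟩; positivity⟩ u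

theorem inf_apply_le_left (M p : Seminorm ℝ C00) (x : C00) : (M ⊓ p) x ≤ M x := by
  simpa using inf_apply_le M p x x

theorem inf_apply_le_right (M p : Seminorm ℝ C00) (x : C00) : (M ⊓ p) x ≤ p x := by
  simpa using inf_apply_le M p x 0

theorem le_inf_apply {M p : Seminorm ℝ C00} {x : C00} {B : ℝ} (h : ∀ u, B ≤ M u + p (x - u)) :
    B ≤ (M ⊓ p) x := by
  rw [Seminorm.inf_apply]
  exact le_ciInf h

/-- An infimal convolution of `M` with a frozen seminorm can be computed by minimizing over
finitely many coordinates. -/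
theorem inf_freeze_apply {M p : Seminorm ℝ C00} (hM : ∀ a, M (Finsupp.single a 1) ≤ 1)
    (L : List Omega1) (x : C00) :
    (M ⊓ freeze {a | a ∈ L} p) x = ⨅ d : ℕ → ℝ, M (x + vec L d) + p (vec L d) := by
  have hb : BddBelow (Set.range fun d : ℕ → ℝ ↦ M (x + vec L d) + p (vec L d)) :=
    ⟨0, by rintro _ ⟨d, rfl⟩; positivity⟩
  refine le_antisymm (le_ciInf fun d ↦ ?_) (le_inf_apply fun u ↦ ?_)
  · refine (inf_apply_le _ _ x (x + vec L d)).trans (add_le_add_right (le_of_eq ?_) _)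
    rw [sub_add_cancel_left, map_neg_eq_map, freeze_of_restr_eq _ (restr_vec (by simp) d)]
  · set J : Set Omega1 := {a | a ∈ L}
    obtain ⟨d, hd⟩ := exists_eq_vec (L := L) (x := restr J (u - x)) fun a ha ↦ by
      classical rw [restr_apply, if_neg (show a ∉ J from ha)]
    refine (ciInf_le hb d).trans ?_
    rw [freeze_apply, ← hd, ← neg_sub u x, map_neg (restr J), map_neg (restr Jᶜ), map_neg_eq_map,
      map_neg_eq_map]
    have h1 : x + restr J (u - x) = u - restr Jᶜ (u - x) := by
      have := restr_add_compl J (u - x)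
      rw [eq_sub_iff_add_eq, add_assoc, this]; abel
    have h2 := map_sub_le_add M u (restr Jᶜ (u - x))
    have h3 := seminorm_le_ell1 hM (restr Jᶜ (u - x))
    rw [h1]
    linarith

/-- The functions induced by an infimal convolution with a frozen seminorm are admissible: the
minimum runs over the finitely many coordinates in `T`. -/
theorem tp_inf_freeze_mem {K : ℝ} {M p : Seminorm ℝ C00} (hM : Good K M) (hp : Good K p)
    (T L : List Omega1) : tp (M ⊓ freeze {a | a ∈ T} p) L ∈ Adm K := by
  classical
  set n := L.length
  set S := (Finset.range (n + T.length)).filter (n ≤ ·)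
  have h := Adm.infProj (Adm.add (hM.tp_mem (L ++ T)) (Adm.restrict (hp.tp_mem (L ++ T)) S)) n
  convert h using 1
  ext c
  rw [tp, inf_freeze_apply (fun a ↦ (hM.single a).le)]
  -- variables with index below `n` belong to `L`, the following ones to `T`
  have hsurj : Function.Surjective fun (d : ℕ → ℝ) (i : ℕ) ↦ d (i + n) :=
    fun d ↦ ⟨fun i ↦ d (i - n), by ext i; simp⟩
  rw [← hsurj.iInf_comp]
  refine iInf_congr fun d ↦ ?_
  simp only [tp, vec_append]
  have e1 : vec L (fun i ↦ if i < n then c i else d i) = vec L c :=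
    vec_congr fun i hi ↦ if_pos hi
  have e2 : vec L (mask S fun i ↦ if i < n then c i else d i) = 0 := by
    rw [← vec_zero L]
    refine vec_congr fun i hi ↦ ?_
    simp [mask, S, not_le.2 (show i < n from hi)]
  have e3 : vec T (fun i ↦ if i + L.length < n then c (i + L.length) else d (i + L.length)) =
      vec T fun i ↦ d (i + n) := by
    refine vec_congr fun i _ ↦ ?_
    simp [n]
  have e4 : vec T (fun i ↦ mask S (fun i ↦ if i < n then c i else d i) (i + L.length)) =
      vec T fun i ↦ d (i + n) := by
    refine vec_congr fun i hi ↦ ?_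
    simp [mask, S, n, add_comm, hi]
  rw [e1, e2, e3, e4, zero_add]

/-- Amalgamation: a good seminorm on the coordinates below `b` and a good seminorm on the
coordinates in `s ∪ {b}`, where `s` is a finite set below `b`, that agree on `s` have a common good
extension. -/
theorem exists_good_amalgam {K : ℝ} (hK : 1 ≤ K) {N p : Seminorm ℝ C00} (hN : Good K N)
    (hp : Good K p) {b : Omega1} {s : List Omega1} (hs : ∀ a ∈ s, a < b)
    (hag : AgreeOn {a | a ∈ s} N p) :
    ∃ q, Good K q ∧ AgreeOn (Set.Iio b) q N ∧ AgreeOn {a | a ∈ b :: s} q p := by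
  classical
  set I : Set Omega1 := {a | a ∈ s}
  set J : Set Omega1 := {a | a ∈ b :: s}
  set M := freeze (Set.Iio b) N
  set P := freeze J p
  -- the extension is the infimal convolution of `M` and `P`
  have hM : Good K M := hN.freeze hK _
  have hP : Good K P := hp.freeze hK _
  have hIJ : I ⊆ J := fun a ha ↦ List.mem_cons_of_mem b ha
  -- dropping the coordinate `b`
  have hsplit : ∀ v : C00, restr J v = restr I v + Finsupp.single b (v b) := by
    intro v
    ext a
    rw [Finsupp.add_apply, restr_apply, restr_apply]
    by_cases hab : a = b
    · subst hab
      have h1 : a ∈ J := List.mem_cons_self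
      have h2 : a ∉ I := fun h ↦ lt_irrefl _ (hs a h)
      simp [h1, h2]
    · have h1 : a ∈ J ↔ a ∈ I := by simp [I, J, hab]
      rw [Finsupp.single_eq_of_ne hab]
      simp [h1]
  have hsingle : ∀ (Q : Seminorm ℝ C00), Good K Q → ∀ t : ℝ, Q (Finsupp.single b t) = |t| := by
    intro Q hQ t
    rw [← mul_one t, ← smul_eq_mul, ← Finsupp.smul_single, map_smul_eq_mul, hQ.single]
    simp
  have hpI : ∀ v, p (restr I v) = N (restr I v) := fun v ↦ (hag _ (restr_idem I v)).symm
  -- dropping the part of a vector outside `J` changes the norm by at most its `ℓ₁`-norm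
  have hbelow : ∀ v, N (restr (Set.Iio b) v) ≤ N (restr I v) + ell1 (restr Jᶜ v) := by
    intro v
    have h1 : restr (Set.Iio b) v = restr I v + restr (Set.Iio b) (restr Jᶜ v) := by
      ext a
      rw [Finsupp.add_apply, restr_apply, restr_apply, restr_apply, restr_apply]
      by_cases hab : a < b
      · have : a ∈ J ↔ a ∈ I := by simp [I, J, hab.ne]
        by_cases haI : a ∈ I <;> simp [haI, hab, this]
      · have : a ∉ I := fun h ↦ hab (hs a h)
        simp [this, hab]
    rw [h1]
    exact (map_add_le_add N _ _).trans
      (add_le_add_right ((hN.le_ell1 _).trans (ell1_restr_le _ _)) _)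
  have hbelow' : ∀ v, N (restr I v) ≤ N (restr (Set.Iio b) v) + ell1 (restr Jᶜ v) := by
    intro v
    have h1 : restr I v = restr (Set.Iio b) v - restr (Set.Iio b) (restr Jᶜ v) := by
      ext a
      rw [Finsupp.sub_apply, restr_apply, restr_apply, restr_apply, restr_apply]
      by_cases hab : a < b
      · have : a ∈ J ↔ a ∈ I := by simp [I, J, hab.ne]
        by_cases haI : a ∈ I <;> simp [haI, hab, this]
      · have : a ∉ I := fun h ↦ hab (hs a h)
        simp [this, hab]
    rw [h1]
    exact (map_sub_le_add N _ _).trans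
      (add_le_add_right ((hN.le_ell1 _).trans (ell1_restr_le _ _)) _)
  have hMb : ∀ u, N (restr (Set.Iio b) u) + |u b| ≤ M u := by
    intro u
    have := abs_apply_le_ell1 (restr (Set.Iio b)ᶜ u) b
    rw [restr_apply, if_pos (by simp)] at this
    exact add_le_add_right this _
  have hqN : AgreeOn (Set.Iio b) (M ⊓ P) N := by
    intro x hx
    refine le_antisymm ?_ (le_inf_apply fun u ↦ ?_)
    · exact (inf_apply_le_left M P x).trans (freeze_of_restr_eq _ hx).le
    · set v := x - u
      have hub : u b = -v b := by
        have : x b = 0 := restr_eq_self.1 hx b (by simp)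
        simp [v, this]
      have h1 : N x ≤ N (restr (Set.Iio b) u) + N (restr (Set.Iio b) v) := by
        conv_lhs => rw [← hx, show x = u + v by simp [v], map_add]
        exact map_add_le_add _ _ _
      have h2 := hbelow v
      have h3 : N (restr I v) ≤ p (restr J v) + |v b| := by
        rw [← hpI, ← hsingle p hp, eq_sub_of_add_eq (hsplit v).symm]
        exact map_sub_le_add p _ _
      have h4 := hMb u
      rw [hub, abs_neg] at h4
      have h5 : P v = p (restr J v) + ell1 (restr Jᶜ v) := rfl
      linarith
  have hqp : AgreeOn J (M ⊓ P) p := by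
    intro x hx
    refine le_antisymm ?_ (le_inf_apply fun u ↦ ?_)
    · exact (inf_apply_le_right M P x).trans (freeze_of_restr_eq _ hx).le
    · have hc : restr Jᶜ (x - u) = -restr Jᶜ u := by
        rw [map_sub, ← hx, restr_restr]; simp [restr_eq_zero.2]
      have h1 : p x ≤ p (restr J (x - u)) + p (restr J u) := by
        conv_lhs => rw [← hx, show x = (x - u) + u by simp, map_add]
        exact map_add_le_add _ _ _
      have h2 : p (restr J u) ≤ N (restr I u) + |u b| := by
        rw [← hpI, ← hsingle p hp, hsplit u]
        exact map_add_le_add p _ _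
      have h3 := hbelow' u
      have h4 := hMb u
      have h5 : P (x - u) = p (restr J (x - u)) + ell1 (restr Jᶜ (x - u)) := rfl
      rw [hc, map_neg_eq_map] at h5
      linarith
  refine ⟨M ⊓ P, ⟨fun l x ↦ ?_, fun a ↦ ?_, fun L ↦ tp_inf_freeze_mem hM hp _ L⟩, hqN, hqp⟩
  · have hK0 : 0 < K := by linarith
    rw [← inv_mul_le_iff₀ hK0]
    refine le_inf_apply fun u ↦ ?_
    rw [inv_mul_le_iff₀ hK0, mul_add]
    refine (inf_apply_le M P _ (initProj l u)).trans (add_le_add (hM.initProj_le l u) ?_)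
    rw [← map_sub]
    exact hP.initProj_le l _
  · rcases lt_trichotomy a b with h | rfl | h
    · rw [hqN _ (by rw [restr_single, if_pos (show a ∈ Set.Iio b from h)]), hN.single]
    · rw [hqp _ (by rw [restr_single, if_pos (show a ∈ J from List.mem_cons_self)]), hp.single]
    · refine le_antisymm ((inf_apply_le_left M P _).trans (hM.single a).le)
        (le_inf_apply fun u ↦ ?_)
      have haJ : a ∉ J := by
        intro hJ
        rcases List.mem_cons.1 hJ with rfl | h'
        · exact lt_irrefl _ h
        · exact lt_asymm h (hs a h')
      have h1 := abs_apply_le_ell1 (restr (Set.Iio b)ᶜ u) a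
      rw [restr_apply, if_pos (show a ∈ (Set.Iio b)ᶜ by simpa using h.le)] at h1
      have h2 := abs_apply_le_ell1 (restr Jᶜ (Finsupp.single a 1 - u)) a
      rw [restr_apply, if_pos (show a ∈ Jᶜ from haJ), Finsupp.sub_apply,
        Finsupp.single_eq_same] at h2
      have h3 : M u = N (restr (Set.Iio b) u) + ell1 (restr (Set.Iio b)ᶜ u) := rfl
      have h4 : P (Finsupp.single a 1 - u) = p (restr J (Finsupp.single a 1 - u)) +
        ell1 (restr Jᶜ (Finsupp.single a 1 - u)) := rfl
      have h5 := apply_nonneg N (restr (Set.Iio b) u)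
      have h6 := apply_nonneg p (restr J (Finsupp.single a 1 - u))
      have h7 : (1 : ℝ) ≤ |u a| + |1 - u a| := by
        have := abs_add_le (u a) (1 - u a)
        simpa using this
      linarith

/-! ### Generic one-step extensions -/

/-- The seminorm `N` is generic at `b` with respect to a family `𝒜` of sets of lists: whenever
`e` is a list of indices up to `b`, `g` is admissible and `A ∈ 𝒜`, either `g` is the function
that `N` induces along `e ++ L` for some `L ∈ A`, or finitely many coordinates of `N` below `b`
prevent every good one-step extension from having this property. -/
def Generic (K : ℝ) (𝒜 : Set (Set (List Omega1))) (b : Omega1) (N : Seminorm ℝ C00) : Prop :=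
  ∀ A ∈ 𝒜, ∀ e : List Omega1, (∀ a ∈ e, a ≤ b) → ∀ g ∈ Adm K,
    (∃ L ∈ A, tp N (e ++ L) = g) ∨
    ∃ C : List Omega1, (∀ a ∈ C, a < b) ∧ (∀ a ∈ e, a ∈ b :: C) ∧
      ∀ q, Good K q → AgreeOn (Set.Iio b) q N → AgreeOn {a | a ∈ b :: C} q N →
        ∀ L ∈ A, tp q (e ++ L) ≠ g

theorem Generic.congr {K : ℝ} {𝒜 : Set (Set (List Omega1))} {b : Omega1} {N M : Seminorm ℝ C00}
    (h : Generic K 𝒜 b N) (h𝒜 : ∀ A ∈ 𝒜, ∀ L ∈ A, ∀ a ∈ L, a < b)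
    (hag : AgreeOn (Set.Iic b) N M) : Generic K 𝒜 b M := by
  intro A hA e he g hg
  rcases h A hA e he g hg with ⟨L, hL, rfl⟩ | ⟨C, hC, heC, hneg⟩
  · refine Or.inl ⟨L, hL, (hag.tp_eq fun a ha ↦ ?_).symm⟩
    rcases List.mem_append.1 ha with h | h
    · exact he a h
    · exact (h𝒜 A hA L hL a h).le
  · refine Or.inr ⟨C, hC, heC, fun q hq h1 h2 ↦ hneg q hq ?_ ?_⟩
    · exact h1.trans (hag.mono Set.Iio_subset_Iic_self).symm
    · refine h2.trans (hag.mono fun a ha ↦ ?_).symm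
      rcases List.mem_cons.1 ha with rfl | h
      · exact Set.mem_Iic.2 le_rfl
      · exact (hC a h).le

/-- A finite approximation of a one-step extension of `N` to the coordinate `b`: a good extension
of which only the restriction to the coordinates in `fin ∪ {b}` is considered as decided. -/
structure Approx (K : ℝ) (N : Seminorm ℝ C00) (b : Omega1) where
  fin : Finset Omega1
  q : Seminorm ℝ C00
  fin_lt : ∀ a ∈ fin, a < b
  good : Good K q
  agree : AgreeOn (Set.Iio b) q N

namespace Approx

variable {K : ℝ} {N : Seminorm ℝ C00} {b : Omega1}

/-- The set of coordinates on which an approximation is decided. -/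
def dom (p : Approx K N b) : Set Omega1 := insert b ↑p.fin

instance : Preorder (Approx K N b) where
  le p p' := p.fin ⊆ p'.fin ∧ AgreeOn p.dom p'.q p.q
  le_refl p := ⟨subset_rfl, fun _ _ ↦ rfl⟩
  le_trans p p' p'' h h' := ⟨h.1.trans h'.1,
    (h'.2.mono (Set.insert_subset_insert (Finset.coe_subset.2 h.1))).trans h.2⟩

theorem dom_mono {p p' : Approx K N b} (h : p ≤ p') : p.dom ⊆ p'.dom :=
  Set.insert_subset_insert (Finset.coe_subset.2 h.1)

/-- Enlarging the set of decided coordinates. -/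
noncomputable def enlarge (p : Approx K N b) (s : Finset Omega1) (hs : ∀ a ∈ s, a < b) :
    Approx K N b where
  fin := p.fin ∪ s
  q := p.q
  fin_lt a ha := (Finset.mem_union.1 ha).elim (p.fin_lt a) (hs a)
  good := p.good
  agree := p.agree

theorem le_enlarge (p : Approx K N b) (s : Finset Omega1) (hs : ∀ a ∈ s, a < b) :
    p ≤ p.enlarge s hs :=
  ⟨Finset.subset_union_left, fun _ _ ↦ rfl⟩

/-- The approximations that decide the coordinate `a`. -/
noncomputable def cofinalMem (a : Set.Iio b) : Order.Cofinal (Approx K N b) where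
  carrier := {p | a.1 ∈ p.fin}
  isCofinal p := ⟨p.enlarge {a.1} (by rintro _ h; rw [Finset.mem_singleton.1 h]; exact a.2),
    by simp [enlarge], p.le_enlarge _ _⟩

/-- The approximations that decide whether some `L ∈ A` has the property `tp q (e ++ L) = g`. -/
noncomputable def cofinalDecide (A : Set (List Omega1)) (hA : ∀ L ∈ A, ∀ a ∈ L, a < b)
    (e : List Omega1) (he : ∀ a ∈ e, a ≤ b) (g : (ℕ → ℝ) → ℝ) : Order.Cofinal (Approx K N b) where
  carrier := {p | (∀ a ∈ e, a ∈ p.dom) ∧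
    ((∃ L ∈ A, (∀ a ∈ L, a ∈ p.dom) ∧ tp p.q (e ++ L) = g) ∨
      ∀ q, Good K q → AgreeOn (Set.Iio b) q N → AgreeOn p.dom q p.q →
        ∀ L ∈ A, tp q (e ++ L) ≠ g)}
  isCofinal p := by
    have hmem : ∀ (p : Approx K N b) (s : Finset Omega1) hs a, a ∈ e.toFinset.filter (· < b) ∪ s →
        a ∈ (p.enlarge (e.toFinset.filter (· < b) ∪ s) hs).dom := fun p s hs a ha ↦
      Set.mem_insert_of_mem _ (Finset.mem_coe.2 (Finset.mem_union_right _ ha))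
    have hmem' : ∀ (p : Approx K N b) (s : Finset Omega1) hs, ∀ a ∈ e,
        a ∈ (p.enlarge (e.toFinset.filter (· < b) ∪ s) hs).dom := by
      intro p s hs a ha
      rcases (he a ha).lt_or_eq with h | rfl
      · exact hmem p s hs a (by simp [ha, h])
      · exact Set.mem_insert _ _
    by_cases h : ∃ q, Good K q ∧ AgreeOn (Set.Iio b) q N ∧ AgreeOn p.dom q p.q ∧
        ∃ L ∈ A, tp q (e ++ L) = g
    · obtain ⟨q, hq, h1, h2, L, hL, hg⟩ := h
      let p' : Approx K N b := ⟨p.fin, q, p.fin_lt, hq, h1⟩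
      have hp' : p ≤ p' := ⟨subset_rfl, h2⟩
      have hs : ∀ a ∈ e.toFinset.filter (· < b) ∪ L.toFinset, a < b := by
        intro a ha
        rcases Finset.mem_union.1 ha with h | h
        · exact (Finset.mem_filter.1 h).2
        · exact hA L hL a (by simpa using h)
      exact ⟨p'.enlarge _ hs, ⟨hmem' p' _ hs, Or.inl ⟨L, hL, fun a ha ↦
        hmem p' _ hs a (by simp [ha]), hg⟩⟩, hp'.trans (p'.le_enlarge _ hs)⟩
    · have hs : ∀ a ∈ e.toFinset.filter (· < b) ∪ ∅, a < b := by simp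
      refine ⟨p.enlarge _ hs, ⟨hmem' p _ hs, Or.inr fun q hq h1 h2 L hL hg ↦ h ?_⟩,
        p.le_enlarge _ hs⟩
      exact ⟨q, hq, h1, h2.mono (dom_mono (p.le_enlarge _ hs)), L, hL, hg⟩

end Approx

/-- Every good seminorm can be modified above and at `b` so that it becomes generic at `b`: the
new seminorm is the limit of a sequence of approximations that decides every instance. -/
theorem exists_generic {K : ℝ} (hK : 1 ≤ K) {N : Seminorm ℝ C00} (hN : Good K N) (b : Omega1)
    {𝒜 : Set (Set (List Omega1))} (hc : 𝒜.Countable) (h𝒜 : ∀ A ∈ 𝒜, ∀ L ∈ A, ∀ a ∈ L, a < b) :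
    ∃ q, Good K q ∧ AgreeOn (Set.Iio b) q N ∧ Generic K 𝒜 b q := by
  classical
  have := hc.to_subtype
  have := (Adm.countable K).to_subtype
  have := (countable_Iio_Omega1 b).to_subtype
  have := (countable_Iic_Omega1 b).to_subtype
  let ι := Set.Iio b ⊕ (𝒜 × List (Set.Iic b) × Adm K)
  have : Encodable ι := Encodable.ofCountable ι
  let 𝒟 : ι → Order.Cofinal (Approx K N b) := fun i ↦ match i with
    | .inl a => Approx.cofinalMem a
    | .inr (A, e, g) => Approx.cofinalDecide A.1 (h𝒜 A.1 A.2) (e.map Subtype.val)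
      (fun a ha ↦ by obtain ⟨x, -, rfl⟩ := List.mem_map.1 ha; exact x.2) g.1
  let p₀ : Approx K N b := ⟨∅, N, by simp, hN, fun _ _ ↦ rfl⟩
  let u := Order.sequenceOfCofinals p₀ 𝒟
  have hu : Monotone u := Order.sequenceOfCofinals.monotone p₀ 𝒟
  have hmeet : ∀ i, ∃ n, u n ∈ 𝒟 i := fun i ↦ ⟨_, Order.sequenceOfCofinals.encode_mem p₀ 𝒟 i⟩
  obtain ⟨q, hq, hqu⟩ := exists_good_limit hK (fun n ↦ (u n).dom) (fun n ↦ (u n).q)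
    (fun i j h ↦ Approx.dom_mono (hu h)) (fun n ↦ (u n).good) (fun i j h ↦ (hu h).2)
  have hqN : AgreeOn (Set.Iio b) q N := by
    intro x hx
    -- a vector supported below `b` is supported in one of the decided sets
    have : ∃ n, ∀ a ∈ x.support, a ∈ (u n).dom := by
      have : ∀ s : Finset Omega1, (∀ a ∈ s, a < b) → ∃ n, ∀ a ∈ s, a ∈ (u n).dom := by
        intro s
        induction s using Finset.induction_on with
        | empty => exact fun _ ↦ ⟨0, by simp⟩
        | insert a s _ ih =>
          intro h
          obtain ⟨n, hn⟩ := ih fun c hc ↦ h c (by simp [hc])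
          obtain ⟨m, hm⟩ := hmeet (.inl ⟨a, h a (by simp)⟩)
          refine ⟨max n m, fun c hc ↦ ?_⟩
          rcases Finset.mem_insert.1 hc with rfl | hc
          · exact Approx.dom_mono (hu (le_max_right n m))
              (Set.mem_insert_of_mem _ (Finset.mem_coe.2 hm))
          · exact Approx.dom_mono (hu (le_max_left n m)) (hn c hc)
      refine this _ fun a ha ↦ ?_
      by_contra h
      exact Finsupp.mem_support_iff.1 ha (restr_eq_self.1 hx a h)
    obtain ⟨n, hn⟩ := this
    rw [hqu n x (restr_eq_self.2 fun a ha ↦ by by_contra h; exact ha (hn a (by simpa using h)))]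
    exact (u n).agree x hx
  refine ⟨q, hq, hqN, fun A hA e he g hg ↦ ?_⟩
  obtain ⟨e', rfl⟩ : ∃ e' : List (Set.Iic b), e = e'.map Subtype.val :=
    ⟨e.attach.map fun a ↦ ⟨a.1, he a.1 a.2⟩, by simp⟩
  obtain ⟨n, hn1, hn2⟩ := hmeet (.inr (⟨A, hA⟩, e', ⟨g, hg⟩))
  have hqn := hqu n
  rcases hn2 with ⟨L, hL, hLd, hLg⟩ | hneg
  · refine Or.inl ⟨L, hL, ?_⟩
    refine (hqn.tp_eq fun a ha ↦ ?_).trans hLg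
    rcases List.mem_append.1 ha with h | h
    · exact hn1 a h
    · exact hLd a h
  · have hdom : {a | a ∈ b :: (u n).fin.toList} = (u n).dom := by
      ext a; simp [Approx.dom]
    refine Or.inr ⟨(u n).fin.toList, by simpa using (u n).fin_lt, fun a ha ↦ ?_,
      fun q' hq' h1 h2 ↦ hneg q' hq' (h1.trans hqN) ?_⟩
    · have := hn1 a ha
      rwa [← hdom] at this
    · rw [hdom] at h2
      exact h2.trans hqn

theorem Generic.mono {K : ℝ} {𝒜 ℬ : Set (Set (List Omega1))} {b : Omega1} {N : Seminorm ℝ C00}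
    (h : Generic K 𝒜 b N) (hsub : ℬ ⊆ 𝒜) : Generic K ℬ b N :=
  fun A hA ↦ h A (hsub hA)

/-- There is a good seminorm that is generic at every coordinate. -/
theorem exists_generic_everywhere {K : ℝ} (hK : 1 ≤ K) (𝒜 : Omega1 → Set (Set (List Omega1)))
    (hc : ∀ b, (𝒜 b).Countable) (h𝒜 : ∀ b, ∀ A ∈ 𝒜 b, ∀ L ∈ A, ∀ a ∈ L, a < b) :
    ∃ N, Good K N ∧ ∀ b, Generic K (𝒜 b) b N := by
  have : Nonempty (Seminorm ℝ C00) := ⟨ell1⟩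
  obtain ⟨f, hf⟩ := exists_of_extension
    (fun b (q : Seminorm ℝ C00) ↦ Good K q ∧ Generic K (𝒜 b) b q)
    (fun c _ p q ↦ AgreeOn (Set.Iic c) q p) (by
      intro b f hf
      obtain ⟨N, hN, hNf⟩ := exists_good_limit hK (ι := Set.Iio b) (fun c ↦ Set.Iic c.1)
        (fun c ↦ f c.1) (fun c d h ↦ Set.Iic_subset_Iic.2 h) (fun c ↦ (hf c.1 c.2).1.1)
        (fun c d h ↦ by
          rcases (show c.1 ≤ d.1 from h).lt_or_eq with h' | h'
          · exact (hf d.1 d.2).2 c.1 h'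
          · rw [h']; exact fun _ _ ↦ rfl)
      obtain ⟨q, hq, hqN, hgen⟩ := exists_generic hK hN b (hc b) (h𝒜 b)
      refine ⟨q, ⟨hq, hgen⟩, fun c hcb ↦ (hqN.mono ?_).trans (hNf ⟨c, hcb⟩)⟩
      exact fun a ha ↦ lt_of_le_of_lt ha hcb)
  obtain ⟨N, hN, hNf⟩ := exists_good_limit hK (fun c ↦ Set.Iic c) f
    (fun c d h ↦ Set.Iic_subset_Iic.2 h) (fun c ↦ (hf c).1.1)
    (fun c d h ↦ by
      rcases h.lt_or_eq with h' | rfl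
      · exact (hf d).2 c h'
      · exact fun _ _ ↦ rfl)
  exact ⟨N, hN, fun b ↦ (hf b).1.2.congr (h𝒜 b) (hNf b).symm⟩

/-! ### Copies of a list that are related to it by transfer -/

open Classical in
/-- The map of the indices that moves the list `L` to the list `w` and fixes all indices outside
`L`. -/
noncomputable def moveTo (L w : List Omega1) (a : Omega1) : Omega1 :=
  if a ∈ L then w.getD (L.idxOf a) a else a

theorem moveTo_of_notMem {L w : List Omega1} {a : Omega1} (h : a ∉ L) : moveTo L w a = a :=
  if_neg h

theorem map_moveTo_self {L w : List Omega1} (hL : L.Pairwise (· < ·))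
    (hlen : L.length = w.length) : L.map (moveTo L w) = w := by
  refine List.ext_getElem (by simpa using hlen) fun i h1 h2 ↦ ?_
  have hi : i < L.length := by simpa using h1
  rw [List.getElem_map, moveTo, if_pos (List.getElem_mem hi),
    List.Nodup.idxOf_getElem (hL.imp ne_of_lt) i hi, List.getD_eq_getElem _ _ h2]

theorem map_moveTo_of_disjoint {L w e : List Omega1} (h : ∀ a ∈ e, a ∉ L) :
    e.map (moveTo L w) = e := by
  conv_rhs => rw [← List.map_id e]
  exact List.map_congr_left fun a ha ↦ moveTo_of_notMem (h a ha)

theorem initProj_vec_of_take_drop {L : List Omega1} {l : Omega1} {j : ℕ}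
    (h1 : ∀ a ∈ L.take j, a < l) (h2 : ∀ a ∈ L.drop j, l ≤ a) (c : ℕ → ℝ) :
    initProj l (vec L c) = vec (L.take j) c := by
  conv_lhs => rw [← List.take_append_drop j L, vec_append, map_add]
  rw [initProj_vec_of_lt h1, initProj_vec_of_le h2, add_zero]

theorem exists_initProj_vec_eq_take {L : List Omega1} (hL : L.Pairwise (· < ·)) (l : Omega1) :
    ∃ j, ∀ c, initProj l (vec L c) = vec (L.take j) c := by
  suffices h : ∃ j, (∀ a ∈ L.take j, a < l) ∧ ∀ a ∈ L.drop j, l ≤ a by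
    obtain ⟨j, h1, h2⟩ := h
    exact ⟨j, initProj_vec_of_take_drop h1 h2⟩
  induction L with
  | nil => exact ⟨0, by simp, by simp⟩
  | cons a L ih =>
    rw [List.pairwise_cons] at hL
    rcases lt_or_ge a l with h | h
    · obtain ⟨j, h1, h2⟩ := ih hL.2
      exact ⟨j + 1, by simpa using ⟨h, h1⟩, by simpa using h2⟩
    · exact ⟨0, by simp, by simpa using ⟨h, fun b hb ↦ h.trans (hL.1 b hb).le⟩⟩

theorem exists_take_eq_initProj_vec {L : List Omega1} (hL : L.Pairwise (· < ·)) {r d : Omega1}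
    (hrd : r ≤ d) (h : ∀ a ∈ L, r ≤ a ∧ a < d) (j : ℕ) :
    ∃ l, r ≤ l ∧ l ≤ d ∧ ∀ c, initProj l (vec L c) = vec (L.take j) c := by
  suffices h : ∃ l, r ≤ l ∧ l ≤ d ∧ (∀ a ∈ L.take j, a < l) ∧ ∀ a ∈ L.drop j, l ≤ a by
    obtain ⟨l, h0, h0', h1, h2⟩ := h
    exact ⟨l, h0, h0', initProj_vec_of_take_drop h1 h2⟩
  rcases lt_or_ge j L.length with hj | hj
  · refine ⟨L[j], (h _ (List.getElem_mem hj)).1, (h _ (List.getElem_mem hj)).2.le, ?_, ?_⟩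
    · intro a ha
      obtain ⟨i, hi, rfl⟩ := List.getElem_of_mem ha
      rw [List.length_take] at hi
      rw [List.getElem_take]
      exact List.pairwise_iff_getElem.1 hL i j (by omega) hj (by omega)
    · intro a ha
      obtain ⟨i, hi, rfl⟩ := List.getElem_of_mem ha
      rw [List.length_drop] at hi
      rw [List.getElem_drop]
      rcases Nat.eq_zero_or_pos i with rfl | hi'
      · simp
      · exact (List.pairwise_iff_getElem.1 hL j (j + i) hj (by omega) (by omega)).le
  · refine ⟨d, hrd, le_rfl, fun a ha ↦ (h a (List.mem_of_mem_take ha)).2, ?_⟩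
    rw [List.drop_eq_nil_of_le hj]; simp

/-- If `d` is a limit, finitely many indices below `d` have a bound below `d`. -/
theorem exists_bound_below {d : Omega1} (hlim : ∀ r < d, ∃ r' < d, r < r') {r : Omega1}
    (hr : r < d) (C : List Omega1) : ∃ r' < d, r ≤ r' ∧ ∀ a ∈ C, a < r' ∨ d ≤ a := by
  induction C with
  | nil => exact ⟨r, hr, le_rfl, by simp⟩
  | cons a C ih =>
    obtain ⟨r', h1, h2, h3⟩ := ih
    rcases lt_or_ge a d with h | h
    · obtain ⟨s, hs, hs'⟩ := hlim (max a r') (max_lt h h1)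
      refine ⟨s, hs, h2.trans ((le_max_right _ _).trans hs'.le), fun x hx ↦ ?_⟩
      rcases List.mem_cons.1 hx with rfl | hx
      · exact Or.inl ((le_max_left _ _).trans_lt hs')
      · exact (h3 x hx).imp_left fun h ↦ h.trans ((le_max_right _ _).trans_lt hs')
    · refine ⟨r', h1, h2, fun x hx ↦ ?_⟩
      rcases List.mem_cons.1 hx with rfl | hx
      · exact Or.inr h
      · exact h3 x hx

section Copies

variable {K : ℝ} {N : Seminorm ℝ C00} {d : Omega1} {w : List Omega1}

/-- The function that the seminorm transferred along `L ↦ w` induces along `e ++ L` does not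
depend on `L`, as long as the position of `L` relative to `e` is fixed. -/
theorem Good.tp_transfer_eq (hK : 1 ≤ K) (hN : Good K N) {r : Omega1} (hr : r ≤ d)
    {e L L' : List Omega1} (he : ∀ a ∈ e, a < r ∨ d ≤ a)
    (hL : L.Pairwise (· < ·)) (hLd : ∀ a ∈ L, r ≤ a ∧ a < d) (hlen : L.length = w.length)
    (hL' : L'.Pairwise (· < ·)) (hLd' : ∀ a ∈ L', r ≤ a ∧ a < d) (hlen' : L'.length = w.length) :
    tp (transferSeminorm K (moveTo L w) N) (e ++ L) =
      tp (transferSeminorm K (moveTo L' w) N) (e ++ L') := by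
  have key : ∀ L L' : List Omega1, L.Pairwise (· < ·) → (∀ a ∈ L, r ≤ a ∧ a < d) →
      L.length = w.length → L'.Pairwise (· < ·) → (∀ a ∈ L', r ≤ a ∧ a < d) →
      L'.length = w.length → ∀ c, transferSeminorm K (moveTo L w) N (vec (e ++ L) c) ≤
        transferSeminorm K (moveTo L' w) N (vec (e ++ L') c) := by
    intro L L' hL hLd hlen hL' hLd' hlen' c
    have hdisj : ∀ L : List Omega1, (∀ a ∈ L, r ≤ a ∧ a < d) → ∀ a ∈ e, a ∉ L := by
      intro L hLd a ha haL
      rcases he a ha with h | h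
      · exact absurd (hLd a haL).1 (not_le.2 h)
      · exact absurd (hLd a haL).2 (not_lt.2 h)
    have hmap : ∀ L : List Omega1, L.Pairwise (· < ·) → (∀ a ∈ L, r ≤ a ∧ a < d) →
        L.length = w.length → (e ++ L).map (moveTo L w) = e ++ w := by
      intro L hL hLd hlen
      rw [List.map_append, map_moveTo_self hL hlen, map_moveTo_of_disjoint (hdisj L hLd)]
    have hfix : ∀ (L : List Omega1), (∀ a ∈ L, r ≤ a ∧ a < d) → ∀ l c',
        Finsupp.lmapDomain ℝ ℝ (moveTo L w) (initProj l (vec e c')) = initProj l (vec e c') := by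
      intro L hLd l c'
      refine lmapDomain_eq_self (J := {a | a ∈ e})
        (fun a ha ↦ moveTo_of_notMem (hdisj L hLd a ha)) ?_
      rw [restr_comm, restr_vec (by simp)]
    have htake : ∀ (L : List Omega1), L.Pairwise (· < ·) → L.length = w.length → ∀ j c',
        Finsupp.lmapDomain ℝ ℝ (moveTo L w) (vec (L.take j) c') = vec (w.take j) c' := by
      intro L hL hlen j c'
      rw [lmapDomain_vec, List.map_take, map_moveTo_self hL hlen]
    -- every cut of `e ++ L` corresponds to a cut of `e ++ L'`
    have hcut : ∀ l, ∃ l', Finsupp.lmapDomain ℝ ℝ (moveTo L w) (initProj l (vec (e ++ L) c)) =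
        Finsupp.lmapDomain ℝ ℝ (moveTo L' w) (initProj l' (vec (e ++ L') c)) := by
      intro l
      simp only [vec_append, map_add, hfix L hLd, hfix L' hLd']
      set c' : ℕ → ℝ := fun i ↦ c (i + e.length)
      rcases le_total l r with h | h
      · refine ⟨l, ?_⟩
        rw [initProj_vec_of_le fun a ha ↦ h.trans (hLd a ha).1,
          initProj_vec_of_le fun a ha ↦ h.trans (hLd' a ha).1, map_zero, map_zero]
      rcases le_total d l with h' | h'
      · refine ⟨l, ?_⟩
        rw [initProj_vec_of_lt fun a ha ↦ (hLd a ha).2.trans_le h',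
          initProj_vec_of_lt fun a ha ↦ (hLd' a ha).2.trans_le h', lmapDomain_vec,
          lmapDomain_vec, map_moveTo_self hL hlen, map_moveTo_self hL' hlen']
      · obtain ⟨j, hj⟩ := exists_initProj_vec_eq_take hL l
        obtain ⟨l', h1, h2, hl'⟩ := exists_take_eq_initProj_vec hL' hr hLd' j
        refine ⟨l', ?_⟩
        rw [hj, hl', htake L hL hlen, htake L' hL' hlen']
        congr 1
        classical
        ext a
        rw [restr_apply, restr_apply]
        by_cases ha : a ∈ e
        · rcases he a ha with h3 | h3
          · rw [if_pos (show a ∈ Set.Iio l from h3.trans_le h),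
              if_pos (show a ∈ Set.Iio l' from h3.trans_le h1)]
          · rw [if_neg (show a ∉ Set.Iio l from not_lt.2 (h'.trans h3)),
              if_neg (show a ∉ Set.Iio l' from not_lt.2 (h2.trans h3))]
        · simp [vec_apply_of_notMem ha]
    refine hN.transfer_le hK ?_ fun l ↦ ?_
    · rw [lmapDomain_vec, hmap L hL hLd hlen, ← hmap L' hL' hLd' hlen', ← lmapDomain_vec]
      exact hN.le_transfer hK _ _
    · obtain ⟨l', hl'⟩ := hcut l
      rw [hl']
      exact hN.initProj_le_transfer hK _ _ l'
  ext c
  exact le_antisymm (key L L' hL hLd hlen hL' hLd' hlen' c)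
    (key L' L hL' hLd' hlen' hL hLd hlen c)

/-- Let `A r` be sets of lists located between `r` and `d`, such that `N` is generic for them at
all coordinates from `d` on, and let `w` be a list above `d` that looks like lists in `A r` over
any finite set of coordinates below `r`. Then, over every finite set `D` of coordinates, some list
in `A r` is related to `w` by transfer. The proof is by induction on the largest element of `D`:
if genericity at that element does not provide a list, it names finitely many smaller coordinates
that prevent this, and over these coordinates the induction hypothesis and amalgamation provide a
one-step extension to the contrary. -/
theorem Good.exists_agreeOn_transfer (hK : 1 ≤ K) (hN : Good K N) {A : Omega1 → Set (List Omega1)}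
    (hA : ∀ r < d, ∀ L ∈ A r, ∀ a ∈ L, r ≤ a ∧ a < d)
    (hA' : ∀ r < d, ∀ L ∈ A r, L.Pairwise (· < ·) ∧ L.length = w.length)
    (hmono : Antitone A)
    (hgen : ∀ b, d ≤ b → Generic K (A '' Set.Iio d) b N)
    (hlim : ∀ r < d, ∃ r' < d, r < r')
    (hlook : ∀ r < d, ∀ e : List Omega1, (∀ a ∈ e, a < r) →
      ∃ L ∈ A r, tp N (e ++ L) = tp N (e ++ w))
    (D : List Omega1) {r : Omega1} (hr : r < d) (hD : ∀ a ∈ D, a < r ∨ d ≤ a) :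
    ∃ L ∈ A r, AgreeOn {a | a ∈ D ++ L} N (transferSeminorm K (moveTo L w) N) := by
  suffices H : ∀ b, ∀ D : List Omega1, (∀ a ∈ D, a < b) → ∀ r < d, (∀ a ∈ D, a < r ∨ d ≤ a) →
      ∃ L ∈ A r, AgreeOn {a | a ∈ D ++ L} N (transferSeminorm K (moveTo L w) N) by
    obtain ⟨b, hb⟩ := exists_gt_of_countable (s := {a | a ∈ D}) D.finite_toSet.countable
    exact H b D hb r hr hD
  have hdisj : ∀ r < d, ∀ D : List Omega1, (∀ a ∈ D, a < r ∨ d ≤ a) → ∀ L ∈ A r,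
      ∀ a ∈ D, a ∉ L := by
    intro r hr D hD L hL a ha haL
    rcases hD a ha with h | h
    · exact absurd (hA r hr L hL a haL).1 (not_le.2 h)
    · exact absurd (hA r hr L hL a haL).2 (not_lt.2 h)
  intro b
  induction b using (wellFounded_lt (α := Omega1)).induction with
  | _ b ih =>
  intro D hDb r hr hD
  by_cases hDd : ∀ a ∈ D, a < d
  · have hDr : ∀ a ∈ D, a < r := fun a ha ↦
      (hD a ha).resolve_right fun h ↦ not_lt.2 h (hDd a ha)
    obtain ⟨L, hL, htp⟩ := hlook r hr D hDr
    refine ⟨L, hL, ?_⟩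
    obtain ⟨hLs, hlen⟩ := hA' r hr L hL
    have hTN : ∀ x : C00, restr {a | a ∈ D ++ L} x = x →
        N (Finsupp.lmapDomain ℝ ℝ (moveTo L w) x) = N x := by
      intro x hx
      obtain ⟨c, rfl⟩ := exists_eq_vec (L := D ++ L) (restr_eq_self.1 hx)
      rw [lmapDomain_vec, List.map_append, map_moveTo_self hLs hlen,
        map_moveTo_of_disjoint (hdisj r hr D hD L hL)]
      exact (congrFun htp c).symm
    intro x hx
    refine le_antisymm ?_ (hN.transfer_le hK (hTN x hx).le fun l ↦ ?_)
    · rw [← hTN x hx]; exact hN.le_transfer hK _ x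
    · rw [hTN _ (by rw [restr_comm, hx])]; exact hN.initProj_le l x
  · -- the largest element of `D` is a coordinate from `d` on
    push Not at hDd
    obtain ⟨a₀, ha₀, hda₀⟩ := hDd
    have hne : D.toFinset.Nonempty := ⟨a₀, by simpa using ha₀⟩
    set m := D.toFinset.max' hne
    have hmD : m ∈ D := by simpa using D.toFinset.max'_mem hne
    have hDm : ∀ a ∈ D, a ≤ m := fun a ha ↦ D.toFinset.le_max' a (by simpa using ha)
    have hdm : d ≤ m := hda₀.trans (hDm a₀ ha₀)
    obtain ⟨L₀, hL₀, -⟩ := hlook r hr [] (by simp)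
    obtain ⟨hLs₀, hlen₀⟩ := hA' r hr L₀ hL₀
    have htp : ∀ L ∈ A r, tp (transferSeminorm K (moveTo L w) N) (D ++ L) =
        tp (transferSeminorm K (moveTo L₀ w) N) (D ++ L₀) := fun L hL ↦
      hN.tp_transfer_eq hK hr.le hD (hA' r hr L hL).1 (hA r hr L hL) (hA' r hr L hL).2
        hLs₀ (hA r hr L₀ hL₀) hlen₀
    rcases hgen m hdm (A r) ⟨r, hr, rfl⟩ D hDm _
      ((hN.transfer hK (moveTo L₀ w)).tp_mem (D ++ L₀)) with ⟨L, hL, h⟩ | ⟨C, hCm, hDC, hneg⟩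
    · exact ⟨L, hL, agreeOn_of_tp_eq (fun a ha ↦ ha) (h.trans (htp L hL).symm)⟩
    · exfalso
      obtain ⟨r', hr'd, hrr', hC⟩ := exists_bound_below hlim hr C
      obtain ⟨L, hL, hag⟩ := ih m (hDb m hmD) C hCm r' hr'd hC
      have hLr : L ∈ A r := hmono hrr' hL
      have hp := hN.transfer hK (moveTo L w)
      obtain ⟨q, hq, hq1, hq2⟩ := exists_good_amalgam hK hN hp (b := m) (s := C ++ L)
        (fun a ha ↦ (List.mem_append.1 ha).elim (hCm a)
          fun h ↦ (hA r' hr'd L hL a h).2.trans_le hdm) hag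
      refine hneg q hq hq1 ?_ L hLr ?_
      · refine (hq2.mono fun a ha ↦ ?_).trans (hN.transfer_agreeOn hK fun a ha ↦ ?_)
        · rcases List.mem_cons.1 ha with rfl | h
          · exact List.mem_cons_self
          · exact List.mem_cons_of_mem _ (List.mem_append_left _ h)
        · refine moveTo_of_notMem (hdisj r' hr'd (m :: C) (fun x hx ↦ ?_) L hL a ha)
          rcases List.mem_cons.1 hx with rfl | h
          · exact Or.inr hdm
          · exact hC x h
      · rw [← htp L hLr]
        refine hq2.tp_eq fun a ha ↦ ?_
        rcases List.mem_append.1 ha with h | h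
        · rcases List.mem_cons.1 (hDC a h) with rfl | h'
          · exact List.mem_cons_self
          · exact List.mem_cons_of_mem _ (List.mem_append_left _ h')
        · exact List.mem_cons_of_mem _ (List.mem_append_right _ h)

end Copies

/-! ### Blocks with almost minimal norm -/

/-- Every list of the family `W` above `d` has, over every finite set of indices, a copy in `W`
below `d` that is related to it by transfer. -/
def CopyAt (K : ℝ) (N : Seminorm ℝ C00) (W : Set (List Omega1)) (d : Omega1) : Prop :=
  ∀ w ∈ W, (∀ a ∈ w, d ≤ a) → ∀ (D : List Omega1), ∀ r < d, (∀ a ∈ D, a < r ∨ d ≤ a) →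
    ∃ L ∈ W, (∀ a ∈ L, r ≤ a ∧ a < d) ∧
      AgreeOn {a | a ∈ D ++ L} N (transferSeminorm K (moveTo L w) N)

section Blocks

variable {K : ℝ} {N : Seminorm ℝ C00} {W : Set (List Omega1)} {d : Omega1}

/-- Copies can be chosen one after the other, each one above the previous copies and related to its
target by transfer over all of them. -/
theorem CopyAt.exists_seq (h : CopyAt K N W d) (hlim : ∀ r < d, ∃ r' < d, r < r')
    {w : ℕ → List Omega1} (hw : ∀ i, w i ∈ W) (hwd : ∀ i, ∀ a ∈ w i, d ≤ a) (D : List Omega1)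
    {r : Omega1} (hr : r < d) (hD : ∀ a ∈ D, a < r ∨ d ≤ a) (m : ℕ) :
    ∃ p : ℕ → List Omega1, ∀ i < m, p i ∈ W ∧ (∀ a ∈ p i, r ≤ a ∧ a < d) ∧
      (∀ j < i, ∀ a ∈ p j, ∀ b ∈ p i, a < b) ∧
      AgreeOn {a | a ∈ D ∨ ∃ j ≤ i, a ∈ p j} N (transferSeminorm K (moveTo (p i) (w i)) N) := by
  induction m with
  | zero => exact ⟨fun _ ↦ [], by simp⟩
  | succ m ih =>
    obtain ⟨p, hp⟩ := ih
    set C := (List.range m).flatMap p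
    have hC : ∀ a, a ∈ C ↔ ∃ j < m, a ∈ p j := by simp [C]
    obtain ⟨r', hr'd, hrr', hr'C⟩ := exists_bound_below hlim hr C
    obtain ⟨L, hL, hLr, hag⟩ := h (w m) (hw m) (hwd m) (D ++ C) r' hr'd fun a ha ↦ by
      rcases List.mem_append.1 ha with h | h
      · exact (hD a h).imp_left fun h ↦ h.trans_le hrr'
      · exact hr'C a h
    refine ⟨Function.update p m L, fun i hi ↦ ?_⟩
    rcases (Nat.lt_succ_iff.1 hi).lt_or_eq with hi | rfl
    · have hne : ∀ j ≤ i, Function.update p m L j = p j := fun j hj ↦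
        Function.update_of_ne (by omega) _ _
      rw [hne i le_rfl]
      obtain ⟨h1, h2, h3, h4⟩ := hp i hi
      refine ⟨h1, h2, fun j hj ↦ by rw [hne j hj.le]; exact h3 j hj, h4.mono ?_⟩
      rintro a (ha | ⟨j, hj, ha⟩)
      · exact Or.inl ha
      · exact Or.inr ⟨j, hj, by rwa [hne j hj] at ha⟩
    · rw [Function.update_self]
      have hne : ∀ j < i, Function.update p i L j = p j := fun j hj ↦
        Function.update_of_ne (by omega) _ _
      refine ⟨hL, fun a ha ↦ ⟨hrr'.trans (hLr a ha).1, (hLr a ha).2⟩, fun j hj a ha b hb ↦ ?_,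
        hag.mono ?_⟩
      · rw [hne j hj] at ha
        rcases hr'C a ((hC a).2 ⟨j, hj, ha⟩) with h | h
        · exact h.trans_le (hLr b hb).1
        · exact absurd ((hp j hj).2.1 a ha).2 (not_lt.2 h)
      · rintro a (ha | ⟨j, hj, ha⟩)
        · exact List.mem_append_left _ (List.mem_append_left _ ha)
        · rcases hj.lt_or_eq with hj | rfl
          · rw [hne j hj] at ha
            exact List.mem_append_left _ (List.mem_append_right _ ((hC a).2 ⟨j, hj, ha⟩))
          · rw [Function.update_self] at ha
            exact List.mem_append_right _ ha

/-- A cut of a block along `L`, moved to `w`, is a cut of the block along `w`. -/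
theorem Good.map_initProj_vec_le (hN : Good K N) {L w : List Omega1}
    (hL : L.Pairwise (· < ·)) (hw : w.Pairwise (· < ·)) (hlen : L.length = w.length) (c : ℕ → ℝ)
    (l : Omega1) : N (Finsupp.lmapDomain ℝ ℝ (moveTo L w) (initProj l (vec L c))) ≤
      K * N (vec w c) := by
  obtain ⟨j, hj⟩ := exists_initProj_vec_eq_take hL l
  rw [hj, lmapDomain_vec, List.map_take, map_moveTo_self hL hlen]
  obtain ⟨b, hb⟩ := exists_gt_of_countable (s := {a | a ∈ w}) w.finite_toSet.countable
  by_cases h0 : w = []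
  · subst h0
    simp only [List.take_nil, vec, map_zero, mul_zero, le_refl]
  · have hhead : ∀ x ∈ w, w.head h0 ≤ x := by
      intro x hx
      obtain ⟨i, hi, rfl⟩ := List.getElem_of_mem hx
      rw [List.head_eq_getElem]
      rcases Nat.eq_zero_or_pos i with rfl | h
      · exact le_rfl
      · exact (List.pairwise_iff_getElem.1 hw 0 i _ hi h).le
    obtain ⟨l', -, -, hl'⟩ := exists_take_eq_initProj_vec hw (r := w.head h0)
      (hb _ (List.head_mem _)).le (fun x hx ↦ ⟨hhead x hx, hb x hx⟩) j
    rw [← hl']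
    exact hN.initProj_le _ _

theorem Good.norm_vec_eq (hN : Good K N) (hK : 1 ≤ K) {L w : List Omega1}
    (hL : L.Pairwise (· < ·)) (hw : w.Pairwise (· < ·)) (hlen : L.length = w.length)
    {J : Set Omega1} (hJ : ∀ a ∈ L, a ∈ J)
    (hag : AgreeOn J N (transferSeminorm K (moveTo L w) N)) (c : ℕ → ℝ) :
    N (vec L c) = N (vec w c) := by
  have hT : Finsupp.lmapDomain ℝ ℝ (moveTo L w) (vec L c) = vec w c := by
    rw [lmapDomain_vec, map_moveTo_self hL hlen]
  rw [hag _ (restr_vec hJ c)]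
  refine le_antisymm (hN.transfer_le hK (by rw [hT]) fun l ↦ ?_) ?_
  · exact hN.map_initProj_vec_le hL hw hlen c l
  · conv_lhs => rw [← hT]
    exact hN.le_transfer hK _ _

/-- Moving the blocks along the lists `p i` to the lists `w i` does not increase the norm. -/
theorem Good.norm_sum_le (hN : Good K N) (hK : 1 ≤ K) {p w : ℕ → List Omega1} {D : List Omega1}
    {m : ℕ} (hps : ∀ i < m, (p i).Pairwise (· < ·)) (hlen : ∀ i < m, (p i).length = (w i).length)
    (hpp : ∀ i < m, ∀ j < i, ∀ a ∈ p j, a ∉ p i) (hpD : ∀ i < m, ∀ a ∈ D, a ∉ p i)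
    (hwD : ∀ i < m, ∀ a ∈ w i, a ∈ D)
    (hag : ∀ i < m, AgreeOn {a | a ∈ D ∨ ∃ j ≤ i, a ∈ p j} N
      (transferSeminorm K (moveTo (p i) (w i)) N)) (c : ℕ → ℝ) :
    N (∑ i ∈ Finset.range m, vec (w i) c) ≤ N (∑ i ∈ Finset.range m, vec (p i) c) := by
  suffices H : ∀ k ≤ m, ∀ y : C00, restr {a | a ∈ D} y = y →
      N (∑ i ∈ Finset.range k, vec (w i) c + y) ≤ N (∑ i ∈ Finset.range k, vec (p i) c + y) by
    simpa using H m le_rfl 0 (by simp)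
  intro k
  induction k with
  | zero => intro _ y _; simp
  | succ k ih =>
    intro hk y hy
    have hk' : k < m := hk
    rw [Finset.sum_range_succ, Finset.sum_range_succ, add_assoc, add_assoc]
    refine (ih hk'.le _ ?_).trans ?_
    · rw [map_add, hy, restr_vec (J := {a | a ∈ D}) (hwD k hk')]
    · have hT : Finsupp.lmapDomain ℝ ℝ (moveTo (p k) (w k))
          (∑ i ∈ Finset.range k, vec (p i) c + (vec (p k) c + y)) =
          ∑ i ∈ Finset.range k, vec (p i) c + (vec (w k) c + y) := by
        rw [map_add, map_add, map_sum, lmapDomain_vec, map_moveTo_self (hps k hk') (hlen k hk'),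
          lmapDomain_eq_self (fun a ha ↦ moveTo_of_notMem (hpD k hk' a ha)) hy]
        congr 1
        refine Finset.sum_congr rfl fun i hi ↦ ?_
        rw [lmapDomain_vec, map_moveTo_of_disjoint (hpp k hk' i (by simpa using hi))]
      rw [← hT, hag k hk' (∑ i ∈ Finset.range k, vec (p i) c + (vec (p k) c + y))]
      · exact hN.le_transfer hK _ _
      · rw [map_add, map_add, map_sum, restr_vec (J := {a | a ∈ D ∨ ∃ j ≤ k, a ∈ p j})
            fun a ha ↦ Or.inr ⟨k, le_rfl, ha⟩,
          restr_mono_self (I := {a | a ∈ D}) (J := {a | a ∈ D ∨ ∃ j ≤ k, a ∈ p j})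
            (fun a ha ↦ Or.inl ha) hy]
        congr 1
        refine Finset.sum_congr rfl fun i hi ↦ restr_vec (fun a ha ↦ Or.inr ⟨i, ?_, ha⟩) c
        have := Finset.mem_range.1 hi
        exact this.le

/-- If only one block of a sequence of consecutive blocks is cut by the projection, then the norm
of the projection of the sum is estimated by the triangle inequality. -/
theorem sum_initProj_le {Q : Seminorm ℝ C00} {p : ℕ → List Omega1} {c : ℕ → ℝ} {z : ℝ}
    (hK : 1 ≤ K) {n : ℕ} {l : Omega1} (hz : 0 ≤ z) (hQ : ∀ i < n, Q (vec (p i) c) ≤ z)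
    (hQ' : ∀ i < n, Q (initProj l (vec (p i) c)) ≤ K * z)
    (hp : ∀ i < n, ∀ j < i, ∀ a ∈ p j, ∀ b ∈ p i, a < b) :
    Q (∑ i ∈ Finset.range n, initProj l (vec (p i) c)) ≤ (n + K) * z := by
  induction n with
  | zero =>
    simp only [Finset.range_zero, Finset.sum_empty, map_zero]
    positivity
  | succ n ih =>
    rw [Finset.sum_range_succ]
    by_cases h : ∀ i < n, ∀ a ∈ p i, a < l
    · have h1 : ∑ i ∈ Finset.range n, initProj l (vec (p i) c) =
          ∑ i ∈ Finset.range n, vec (p i) c :=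
        Finset.sum_congr rfl fun i hi ↦ initProj_vec_of_lt (h i (Finset.mem_range.1 hi)) c
      have h2 : Q (∑ i ∈ Finset.range n, vec (p i) c) ≤ n * z := by
        refine (Finset.le_sum_of_subadditive Q (map_zero Q).le (map_add_le_add Q) _ _).trans ?_
        refine (Finset.sum_le_card_nsmul _ _ z fun i hi ↦ hQ i ?_).trans_eq (by simp)
        exact (Finset.mem_range.1 hi).trans (Nat.lt_succ_self n)
      rw [h1]
      refine (map_add_le_add Q _ _).trans ((add_le_add h2 (hQ' n (Nat.lt_succ_self n))).trans ?_)
      push_cast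
      linarith
    · push Not at h
      obtain ⟨i, hi, a, ha, hla⟩ := h
      rw [initProj_vec_of_le fun b hb ↦ hla.trans (hp n (Nat.lt_succ_self n) i hi a ha b hb).le,
        add_zero]
      refine (ih (fun i hi ↦ hQ i (by omega)) (fun i hi ↦ hQ' i (by omega))
        fun i hi ↦ hp i (by omega)).trans ?_
      push_cast
      linarith

/-- The alternating sum of blocks along `p 0 < ... < p (m - 1) < q (m - 1) < ... < q 0` has
essentially the smallest norm that is compatible with the bound `K` for the initial projections:
applying the transfer from `p k` to `q k` cancels the last remaining pair of blocks. -/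
theorem Good.norm_sum_sub_le (hN : Good K N) (hK : 1 ≤ K) {p q : ℕ → List Omega1}
    {D : List Omega1} {m : ℕ} {c : ℕ → ℝ} {z : ℝ} (hz : 0 ≤ z)
    (hps : ∀ i < m, (p i).Pairwise (· < ·)) (hqs : ∀ i < m, (q i).Pairwise (· < ·))
    (hlen : ∀ i < m, (p i).length = (q i).length) (hne : ∀ i < m, q i ≠ [])
    (hpp : ∀ i < m, ∀ j < i, ∀ a ∈ p j, ∀ b ∈ p i, a < b)
    (hqq : ∀ i < m, ∀ j < i, ∀ a ∈ q i, ∀ b ∈ q j, a < b)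
    (hpd : ∀ i < m, ∀ a ∈ p i, a < d) (hqd : ∀ i < m, ∀ a ∈ q i, d ≤ a)
    (hqD : ∀ i < m, ∀ a ∈ q i, a ∈ D)
    (hag : ∀ i < m, AgreeOn {a | a ∈ D ∨ ∃ j ≤ i, a ∈ p j} N
      (transferSeminorm K (moveTo (p i) (q i)) N))
    (hpz : ∀ i < m, N (vec (p i) c) = z) (hqz : ∀ i < m, N (vec (q i) c) = z) :
    N (∑ i ∈ Finset.range m, (vec (p i) c - vec (q i) c)) ≤ (m + K) * z / K := by
  have hK0 : 0 < K := by linarith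
  suffices H : ∀ k ≤ m, N (∑ i ∈ Finset.range k, (vec (p i) c - vec (q i) c)) ≤ (k + K) * z / K ∧
      ∀ l, N (initProj l (∑ i ∈ Finset.range k, (vec (p i) c - vec (q i) c))) ≤ (k + K) * z from
    (H m le_rfl).1
  intro k
  induction k with
  | zero =>
    intro _
    simp only [Finset.range_zero, Finset.sum_empty, map_zero]
    exact ⟨by positivity, fun _ ↦ by positivity⟩
  | succ k ih =>
    intro hk
    have hk' : k < m := hk
    obtain ⟨ih1, ih2⟩ := ih hk'.le
    set Y := ∑ i ∈ Finset.range k, (vec (p i) c - vec (q i) c)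
    set Y' := ∑ i ∈ Finset.range (k + 1), (vec (p i) c - vec (q i) c) with hY'
    have hYY' : Y' = Y + (vec (p k) c - vec (q k) c) := Finset.sum_range_succ _ _
    set T := Finsupp.lmapDomain ℝ ℝ (moveTo (p k) (q k))
    have hqfix : ∀ i < m, ∀ a ∈ q i, a ∉ p k := fun i hi a ha h ↦
      absurd (hpd k hk' a h) (not_lt.2 (hqd i hi a ha))
    have hpfix : ∀ i < k, ∀ a ∈ p i, a ∉ p k := fun i hi a ha h ↦
      lt_irrefl a (hpp k hk' i hi a ha a h)
    have hTp : ∀ i < k, ∀ l, T (initProj l (vec (p i) c)) = initProj l (vec (p i) c) := by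
      intro i hi l
      refine lmapDomain_eq_self (J := {a | a ∈ p i}) (fun a ha ↦
        moveTo_of_notMem (hpfix i hi a ha)) ?_
      rw [restr_comm, restr_vec (by simp)]
    have hTq : ∀ i < m, ∀ l, T (initProj l (vec (q i) c)) = initProj l (vec (q i) c) := by
      intro i hi l
      refine lmapDomain_eq_self (J := {a | a ∈ q i}) (fun a ha ↦
        moveTo_of_notMem (hqfix i hi a ha)) ?_
      rw [restr_comm, restr_vec (by simp)]
    have hTp' : ∀ i < k, T (vec (p i) c) = vec (p i) c := fun i hi ↦ by
      rw [lmapDomain_vec, map_moveTo_of_disjoint (hpfix i hi)]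
    have hTq' : ∀ i < m, T (vec (q i) c) = vec (q i) c := fun i hi ↦ by
      rw [lmapDomain_vec, map_moveTo_of_disjoint (hqfix i hi)]
    have hTk : T (vec (p k) c) = vec (q k) c := by
      rw [lmapDomain_vec, map_moveTo_self (hps k hk') (hlen k hk')]
    have hTY : T Y = Y := by
      rw [map_sum]
      refine Finset.sum_congr rfl fun i hi ↦ ?_
      have hi := Finset.mem_range.1 hi
      rw [map_sub, hTp' i hi, hTq' i (hi.trans hk')]
    have hTPY : ∀ l, T (initProj l Y) = initProj l Y := by
      intro l
      rw [map_sum, map_sum]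
      refine Finset.sum_congr rfl fun i hi ↦ ?_
      have hi := Finset.mem_range.1 hi
      rw [map_sub, map_sub, hTp i hi, hTq i (hi.trans hk')]
    have hTY' : T Y' = Y := by
      rw [hYY', map_add, map_sub, hTY, hTk, hTq' k hk', sub_self, add_zero]
    -- the images under `T` of the initial projections of the sum
    have hcut : ∀ l, N (T (initProj l Y')) ≤ ((k + 1 : ℕ) + K) * z := by
      intro l
      by_cases hl : ∀ a ∈ q k, a < l
      · -- the last pair is not cut and cancels
        obtain ⟨a, ha⟩ := List.exists_mem_of_ne_nil _ (hne k hk')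
        have hpl : ∀ x ∈ p k, x < l := fun x hx ↦
          (hpd k hk' x hx).trans ((hqd k hk' a ha).trans_lt (hl a ha))
        rw [hYY', map_add, map_sub, initProj_vec_of_lt hpl, initProj_vec_of_lt hl, map_add,
          map_sub, hTk, hTq' k hk', sub_self, add_zero, hTPY]
        refine (ih2 l).trans ?_
        push_cast
        linarith
      · -- the remaining blocks along the lists `q i` lie behind the cut
        push Not at hl
        obtain ⟨a, ha, hla⟩ := hl
        have hsum : T (initProj l Y') =
            T (∑ i ∈ Finset.range (k + 1), initProj l (vec (p i) c)) -
              initProj l (vec (q k) c) := by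
          rw [hY', map_sum]
          simp only [map_sub]
          rw [Finset.sum_sub_distrib, map_sub, Finset.sum_range_succ
            (fun i ↦ initProj l (vec (q i) c)), Finset.sum_eq_zero (s := Finset.range k)
            fun i hi ↦ initProj_vec_of_le (fun b hb ↦
              hla.trans (hqq k hk' i (Finset.mem_range.1 hi) a ha b hb).le) c, zero_add, hTq k hk']
        have hle : ∀ i < k + 1, N (T (vec (p i) c)) ≤ z := by
          intro i hi
          rcases (Nat.lt_succ_iff.1 hi).lt_or_eq with hi' | rfl
          · rw [hTp' i hi', hpz i (by omega)]
          · rw [hTk, hqz i hk']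
        rw [hsum]
        rcases le_total l d with h | h
        · rw [initProj_vec_of_le fun b hb ↦ h.trans (hqd k hk' b hb), sub_zero]
          refine sum_initProj_le (Q := N.comp T) hK hz hle (fun i hi ↦ ?_) fun i hi ↦
            hpp i (by omega)
          rcases (Nat.lt_succ_iff.1 hi).lt_or_eq with hi' | rfl
          · rw [Seminorm.comp_apply, hTp i hi', ← hpz i (by omega)]
            exact hN.initProj_le _ _
          · rw [Seminorm.comp_apply, ← hqz i hk']
            exact hN.map_initProj_vec_le (hps i hk') (hqs i hk') (hlen i hk') c l
        · refine (map_sub_le_add N _ _).trans ?_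
          rw [add_mul]
          refine add_le_add ?_ ?_
          · rw [Finset.sum_congr rfl fun i hi ↦ initProj_vec_of_lt (fun b hb ↦
              (hpd i ((Finset.mem_range.1 hi).trans_le hk) b hb).trans_le h) c]
            refine (Finset.le_sum_of_subadditive (N.comp T) (map_zero (N.comp T)).le
              (map_add_le_add (N.comp T)) _ _).trans ?_
            exact (Finset.sum_le_card_nsmul _ _ z fun i hi ↦
              hle i (Finset.mem_range.1 hi)).trans_eq (by simp)
          · rw [← hqz k hk']; exact hN.initProj_le _ _
    have hsupp : restr {a | a ∈ D ∨ ∃ j ≤ k, a ∈ p j} Y' = Y' := by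
      rw [hY', map_sum]
      refine Finset.sum_congr rfl fun i hi ↦ ?_
      have hi := Nat.lt_succ_iff.1 (Finset.mem_range.1 hi)
      rw [map_sub, restr_vec (J := {a | a ∈ D ∨ ∃ j ≤ k, a ∈ p j}) fun a ha ↦ Or.inr ⟨i, hi, ha⟩,
        restr_vec (J := {a | a ∈ D ∨ ∃ j ≤ k, a ∈ p j}) fun a ha ↦ Or.inl (hqD i (by omega) a ha)]
    constructor
    · rw [hag k hk' _ hsupp]
      refine hN.transfer_le hK ?_ fun l ↦ ?_
      · change N (T Y') ≤ _
        rw [hTY']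
        refine ih1.trans ?_
        push_cast
        gcongr
        linarith
      · rw [mul_div_cancel₀ _ hK0.ne']
        exact hcut l
    · intro l
      rw [hag k hk' _ (by rw [restr_comm, hsupp])]
      refine hN.transfer_le hK (hcut l) fun l' ↦ ?_
      rw [initProj_initProj]
      exact (hcut _).trans (le_mul_of_one_le_left (by positivity) hK)

/-- Blocks `p i` and `q i` of the same pattern, separated by `d`, for which the norm of the sum of
the first ones is as large as possible, while that of the difference of the two sums is almost as
small as possible. -/
theorem Good.exists_blocks (hN : Good K N) (hK : 1 ≤ K) {d' : Omega1} (hd : d < d')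
    (hW : ∀ L ∈ W, L.Pairwise (· < ·)) {n : ℕ} (hn : 0 < n) (hlen : ∀ L ∈ W, L.length = n)
    (h : CopyAt K N W d) (hlim : ∀ r < d, ∃ r' < d, r < r') {r : Omega1} (hr : r < d)
    (h' : CopyAt K N W d') (hlim' : ∀ r < d', ∃ r' < d', r < r')
    {w : List Omega1} (hw : w ∈ W) (hwd : ∀ a ∈ w, d' ≤ a) (c : ℕ → ℝ) (m : ℕ) :
    ∃ p q : ℕ → List Omega1, (∀ i < m, p i ∈ W ∧ ∀ a ∈ p i, a < d) ∧
      (∀ i < m, q i ∈ W ∧ ∀ a ∈ q i, d ≤ a) ∧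
      m * N (vec w c) ≤ N (∑ i ∈ Finset.range m, vec (p i) c) ∧
      N (∑ i ∈ Finset.range m, (vec (p i) c - vec (q i) c)) ≤ (m + K) * N (vec w c) / K := by
  obtain ⟨u, hu⟩ := h'.exists_seq hlim' (w := fun _ ↦ w) (fun _ ↦ hw) (fun _ ↦ hwd) w hd
    (fun a ha ↦ Or.inr (hwd a ha)) m
  -- the lists are used in decreasing order
  set q : ℕ → List Omega1 := fun i ↦ if i < m then u (m - 1 - i) else w
  have hq : ∀ i < m, q i = u (m - 1 - i) := fun i hi ↦ if_pos hi
  have hqW : ∀ i, q i ∈ W := by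
    intro i
    by_cases hi : i < m
    · rw [hq i hi]; exact (hu _ (by omega)).1
    · simpa [q, hi] using hw
  have hqd : ∀ i, ∀ a ∈ q i, d ≤ a := by
    intro i a ha
    by_cases hi : i < m
    · rw [hq i hi] at ha; exact ((hu _ (by omega)).2.1 a ha).1
    · simp only [q, hi, if_false] at ha; exact hd.le.trans (hwd a ha)
  set D := (List.range m).flatMap q
  have hD : ∀ a, a ∈ D ↔ ∃ i < m, a ∈ q i := by simp [D]
  have hDd : ∀ a ∈ D, d ≤ a := fun a ha ↦ by
    obtain ⟨i, -, hi⟩ := (hD a).1 ha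
    exact hqd i a hi
  obtain ⟨p, hp⟩ := h.exists_seq hlim hqW hqd D hr (fun a ha ↦ Or.inr (hDd a ha)) m
  have huw : ∀ i < m, N (vec (u i) c) = N (vec w c) := fun i hi ↦
    hN.norm_vec_eq hK (hW _ (hu i hi).1) (hW _ hw) (by rw [hlen _ (hu i hi).1, hlen _ hw])
      (fun a ha ↦ Or.inr ⟨i, le_rfl, ha⟩) (hu i hi).2.2.2 c
  have hqw : ∀ i < m, N (vec (q i) c) = N (vec w c) := fun i hi ↦ by
    rw [hq i hi]; exact huw _ (by omega)
  have hlen' : ∀ i < m, (p i).length = (q i).length := fun i hi ↦ by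
    rw [hlen _ (hp i hi).1, hlen _ (hqW i)]
  have hpw : ∀ i < m, N (vec (p i) c) = N (vec w c) := fun i hi ↦ by
    rw [← hqw i hi]
    exact hN.norm_vec_eq hK (hW _ (hp i hi).1) (hW _ (hqW i)) (hlen' i hi)
      (fun a ha ↦ Or.inr ⟨i, le_rfl, ha⟩) (hp i hi).2.2.2 c
  refine ⟨p, q, fun i hi ↦ ⟨(hp i hi).1, fun a ha ↦ ((hp i hi).2.1 a ha).2⟩,
    fun i _ ↦ ⟨hqW i, hqd i⟩, ?_, ?_⟩
  · have h1 : N (∑ i ∈ Finset.range m, vec w c) ≤ N (∑ i ∈ Finset.range m, vec (u i) c) :=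
      hN.norm_sum_le hK (w := fun _ ↦ w) (D := w) (fun i hi ↦ hW _ (hu i hi).1)
        (fun i hi ↦ by rw [hlen _ (hu i hi).1, hlen _ hw])
        (fun i hi j hj a ha hb ↦ lt_irrefl a ((hu i hi).2.2.1 j hj a ha a hb))
        (fun i hi a ha hb ↦ absurd ((hu i hi).2.1 a hb).2 (not_lt.2 (hwd a ha)))
        (fun _ _ _ ha ↦ ha) (fun i hi ↦ (hu i hi).2.2.2) c
    have h2 : N (∑ i ∈ Finset.range m, vec (q i) c) ≤ N (∑ i ∈ Finset.range m, vec (p i) c) :=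
      hN.norm_sum_le hK (fun i hi ↦ hW _ (hp i hi).1) hlen'
        (fun i hi j hj a ha hb ↦ lt_irrefl a ((hp i hi).2.2.1 j hj a ha a hb))
        (fun i hi a ha hb ↦ absurd ((hp i hi).2.1 a hb).2 (not_lt.2 (hDd a ha)))
        (fun i hi a ha ↦ (hD a).2 ⟨i, hi, ha⟩) (fun i hi ↦ (hp i hi).2.2.2) c
    have h3 : ∑ i ∈ Finset.range m, vec (q i) c = ∑ i ∈ Finset.range m, vec (u i) c := by
      rw [← Finset.sum_range_reflect]
      refine Finset.sum_congr rfl fun i hi ↦ ?_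
      have hi := Finset.mem_range.1 hi
      rw [hq _ (by omega)]
      congr 2
      omega
    rw [h3] at h2
    refine le_trans (le_of_eq ?_) (h1.trans h2)
    rw [Finset.sum_const, Finset.card_range, ← Nat.cast_smul_eq_nsmul ℝ, map_smul_eq_mul]
    simp
  · refine hN.norm_sum_sub_le hK (d := d) (D := D) (apply_nonneg _ _)
      (fun i hi ↦ hW _ (hp i hi).1) (fun i _ ↦ hW _ (hqW i)) hlen' (fun i _ h0 ↦ ?_)
      (fun i hi ↦ (hp i hi).2.2.1) (fun i hi j hj a ha b hb ↦ ?_)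
      (fun i hi a ha ↦ ((hp i hi).2.1 a ha).2) (fun i _ ↦ hqd i)
      (fun i hi a ha ↦ (hD a).2 ⟨i, hi, ha⟩) (fun i hi ↦ (hp i hi).2.2.2) hpw hqw
    · have := hlen _ (hqW i)
      rw [h0, List.length_nil] at this
      omega
    · rw [hq i hi] at ha
      rw [hq j (by omega)] at hb
      exact (hu _ (by omega)).2.2.1 _ (by omega) a ha b hb

end Blocks

/-! ### Guessing families of lists -/

/-- The lists between `r` and `d` whose code belongs to the guess at `d`. -/
def guessed (code : List Omega1 → Omega1) (G : Omega1 → Set Omega1) (d r : Omega1) :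
    Set (List Omega1) :=
  {L | code L ∈ G d ∧ ∀ a ∈ L, r ≤ a ∧ a < d}

/-- The families of guessed lists that are available at `b`. -/
def guessedFamilies (code : List Omega1 → Omega1) (G : Omega1 → Set Omega1) (b : Omega1) :
    Set (Set (List Omega1)) :=
  {A | ∃ d ≤ b, ∃ r < d, A = guessed code G d r}

theorem countable_guessedFamilies (code : List Omega1 → Omega1) (G : Omega1 → Set Omega1)
    (b : Omega1) : (guessedFamilies code G b).Countable := by
  refine (Set.Countable.image2 (countable_Iic_Omega1 b) (countable_Iio_Omega1 b)
    (guessed code G)).mono ?_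
  rintro _ ⟨d, hd, r, hr, rfl⟩
  exact ⟨d, hd, r, hr.trans_le hd, rfl⟩

section Guessing

variable {K : ℝ} {N : Seminorm ℝ C00} {n : ℕ} {F : Omega1 → List Omega1}

/-- A bound for the values that are relevant for reflecting the sequence `F` to a club set. -/
theorem exists_reflection_bound (hadm : ∀ L, tp N L ∈ Adm K) (code : List Omega1 → Omega1)
    (F : Omega1 → List Omega1) (f : Omega1 → Omega1) (x : Omega1) :
    ∃ y, f x < y ∧ x < y ∧ (∀ L : List Omega1, (∀ a ∈ L, a ≤ x) → code L < y) ∧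
      (∀ a ∈ F x, a < y) ∧
      ∀ e : List Omega1, (∀ a ∈ e, a ≤ x) → ∀ b ≥ x,
        ∃ c ≥ x, tp N (e ++ F c) = tp N (e ++ F b) ∧ ∀ a ∈ F c, a < y := by
  classical
  have := (countable_Iic_Omega1 x).to_subtype
  have := (Adm.countable K).to_subtype
  have hlist : {L : List Omega1 | ∀ a ∈ L, a ≤ x}.Countable := by
    refine (Set.countable_range fun L : List (Set.Iic x) ↦ L.map Subtype.val).mono fun L hL ↦ ?_
    exact ⟨L.attach.map fun a ↦ ⟨a.1, hL a.1 a.2⟩, by simp⟩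
  have hpairs : ({L : List Omega1 | ∀ a ∈ L, a ≤ x} ×ˢ Adm K).Countable :=
    hlist.prod (Adm.countable K)
  let u : List Omega1 × ((ℕ → ℝ) → ℝ) → Omega1 := fun s ↦
    if h : ∃ c ≥ x, tp N (s.1 ++ F c) = s.2 then h.choose else x
  have hu : ∀ s, (∃ c ≥ x, tp N (s.1 ++ F c) = s.2) → u s ≥ x ∧ tp N (s.1 ++ F (u s)) = s.2 := by
    intro s h
    simp only [u, dif_pos h]
    exact h.choose_spec
  have hfin : ∀ L : List Omega1, {a | a ∈ L}.Countable := fun L ↦ L.finite_toSet.countable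
  obtain ⟨y, hy⟩ := exists_gt_of_countable (((((hpairs.biUnion fun s _ ↦ hfin (F (u s))).union
    (hlist.image code)).union (hfin (F x))).insert x).insert (f x))
  refine ⟨y, hy _ (by simp), hy _ (by simp), fun L hL ↦ hy _ ?_, fun a ha ↦ hy _ ?_,
    fun e he b hb ↦ ?_⟩
  · exact Or.inr (Or.inr (Or.inl (Or.inr ⟨L, hL, rfl⟩)))
  · exact Or.inr (Or.inr (Or.inr ha))
  · obtain ⟨h1, h2⟩ := hu (e, tp N (e ++ F b)) ⟨b, hb, rfl⟩
    refine ⟨_, h1, h2, fun a ha ↦ hy _ (Or.inr (Or.inr (Or.inl (Or.inl ?_))))⟩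
    exact Set.mem_biUnion (show (e, tp N (e ++ F b)) ∈ _ from ⟨he, hadm _⟩) ha

theorem Good.exists_copyAt (hK : 1 ≤ K) (hN : Good K N) {code : List Omega1 → Omega1}
    (hcode : Function.Injective code) {G : Omega1 → Set Omega1}
    (hG : ∀ S : Set Omega1, IsStationary {d : Omega1 | S ∩ Set.Iio d = G d})
    (hgen : ∀ b, Generic K (guessedFamilies code G b) b N)
    (hn : 0 < n) (hlen : ∀ x, (F x).length = n) (hsort : ∀ x, (F x).Pairwise (· < ·))
    (hF : ∀ x, ∀ a ∈ F x, x ≤ a) (f : Omega1 → Omega1) (c : Omega1) :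
    ∃ d, c < d ∧ (∀ x < d, f x < d) ∧ CopyAt K N (Set.range F) d := by
  choose g hg1 hg2 hg3 hg4 hg5 using exists_reflection_bound hN.tp_mem code F f
  obtain ⟨d, hdS, hcd, hgd⟩ := hG (code '' Set.range F) (isClub_closedUnder g c)
  have hlim : ∀ r < d, ∃ r' < d, r < r' := fun r hr ↦ ⟨g r, hgd r hr, hg2 r⟩
  have hmem : ∀ r, ∀ L ∈ guessed code G d r, L ∈ Set.range F := by
    intro r L hL
    have h1 : code L ∈ G d := hL.1
    rw [← hdS] at h1
    obtain ⟨L', hL', h2⟩ := h1.1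
    rwa [← hcode h2]
  refine ⟨d, hcd, fun x hx ↦ (hg1 x).trans (hgd x hx), ?_⟩
  rintro _ ⟨b, rfl⟩ hbd D r hr hD
  have hb : d ≤ b := by
    by_contra h
    obtain ⟨a, ha⟩ := List.exists_mem_of_length_pos (hn.trans_eq (hlen b).symm)
    exact absurd (hbd a ha) (not_le.2 ((hg4 b a ha).trans (hgd b (not_le.1 h))))
  obtain ⟨L, hL, hag⟩ := hN.exists_agreeOn_transfer hK (d := d) (w := F b)
    (A := guessed code G d) (fun r _ L hL ↦ hL.2)
    (fun r _ L hL ↦ by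
      obtain ⟨x, rfl⟩ := hmem r L hL
      exact ⟨hsort x, by rw [hlen, hlen]⟩)
    (fun r r' h L hL ↦ ⟨hL.1, fun a ha ↦ ⟨h.trans (hL.2 a ha).1, (hL.2 a ha).2⟩⟩)
    (fun b' hb' ↦ (hgen b').mono (by
      rintro _ ⟨r, hr, rfl⟩
      exact ⟨d, hb', r, hr, rfl⟩))
    hlim
    (fun r hr e he ↦ by
      obtain ⟨x, hx, htp, hxg⟩ := hg5 r e (fun a ha ↦ (he a ha).le) b (hr.le.trans hb)
      have hxd : ∀ a ∈ F x, a < d := fun a ha ↦ (hxg a ha).trans (hgd r hr)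
      refine ⟨F x, ⟨?_, fun a ha ↦ ⟨le_trans hx (hF x a ha), hxd a ha⟩⟩, htp⟩
      rw [← hdS]
      refine ⟨⟨F x, ⟨x, rfl⟩, rfl⟩, ?_⟩
      obtain ⟨r', hr', -, h⟩ := exists_bound_below hlim hr (F x)
      exact (hg3 r' (F x) fun a ha ↦ ((h a ha).resolve_right (not_le.2 (hxd a ha))).le).trans
        (hgd r' hr'))
    D hr hD
  exact ⟨L, hmem r L hL, hL.2, hag⟩

end Guessing

/-- Under `◇` there is a good seminorm for which every uncountable family of blocks with the same
pattern contains finite families with the properties of `Good.exists_blocks`. -/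
theorem exists_good_seminorm (hDiamond : JensenDiamond) {K : ℝ} (hK : 1 ≤ K) :
    ∃ N, Good K N ∧ ∀ (F : Omega1 → List Omega1) (n : ℕ), 0 < n → (∀ x, (F x).length = n) →
      (∀ x, (F x).Pairwise (· < ·)) → (∀ x, ∀ a ∈ F x, x ≤ a) →
      ∀ (f : Omega1 → Omega1) (c : ℕ → ℝ) (m : ℕ), ∃ (d b : Omega1) (p q : ℕ → Omega1),
        (∀ x < d, f x < d) ∧ (∀ i < m, p i < d) ∧ (∀ i < m, d ≤ q i) ∧
        m * N (vec (F b) c) ≤ N (∑ i ∈ Finset.range m, vec (F (p i)) c) ∧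
        N (∑ i ∈ Finset.range m, (vec (F (p i)) c - vec (F (q i)) c)) ≤
          (m + K) * N (vec (F b) c) / K := by
  obtain ⟨G, -, hG⟩ := hDiamond
  obtain ⟨code, hcode⟩ := exists_list_injection
  obtain ⟨N, hN, hgen⟩ := exists_generic_everywhere hK (guessedFamilies code G)
    (countable_guessedFamilies code G) (by
      rintro b _ ⟨d, hd, r, -, rfl⟩ L hL a ha
      exact (hL.2 a ha).2.trans_le hd)
  refine ⟨N, hN, fun F n hn hlen hsort hF f c m ↦ ?_⟩
  -- `f'` bounds `f` and the lists `F x`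
  have hf' : ∀ x, ∃ y, f x < y ∧ x < y ∧ ∀ a ∈ F x, a < y := by
    intro x
    obtain ⟨y, hy⟩ := exists_gt_of_countable
      (((F x).finite_toSet.countable.insert x).insert (f x))
    exact ⟨y, hy _ (by simp), hy _ (by simp), fun a ha ↦ hy a (by simp [ha])⟩
  choose f' hf1 hf2 hf3 using hf'
  obtain ⟨r⟩ : Nonempty Omega1 := inferInstance
  obtain ⟨d, hrd, hfd, hd⟩ := hN.exists_copyAt hK hcode hG hgen hn hlen hsort hF f' r
  obtain ⟨d', hdd', hfd', hd'⟩ := hN.exists_copyAt hK hcode hG hgen hn hlen hsort hF f' d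
  have hmem : ∀ x, ∃ a, a ∈ F x := fun x ↦
    List.exists_mem_of_length_pos (hn.trans_eq (hlen x).symm)
  obtain ⟨p, q, hp, hq, h1, h2⟩ := hN.exists_blocks hK hdd' (W := Set.range F)
    (by rintro _ ⟨x, rfl⟩; exact hsort x) hn (by rintro _ ⟨x, rfl⟩; exact hlen x) hd
    (fun x hx ↦ ⟨f' x, hfd x hx, hf2 x⟩) hrd hd' (fun x hx ↦ ⟨f' x, hfd' x hx, hf2 x⟩)
    ⟨d', rfl⟩ (fun a ha ↦ hF d' a ha) c m
  have hp' : ∀ i, ∃ x, i < m → F x = p i := fun i ↦ by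
    by_cases hi : i < m
    · obtain ⟨x, hx⟩ := (hp i hi).1
      exact ⟨x, fun _ ↦ hx⟩
    · exact ⟨r, fun h ↦ absurd h hi⟩
  have hq' : ∀ i, ∃ x, i < m → F x = q i := fun i ↦ by
    by_cases hi : i < m
    · obtain ⟨x, hx⟩ := (hq i hi).1
      exact ⟨x, fun _ ↦ hx⟩
    · exact ⟨r, fun h ↦ absurd h hi⟩
  choose p' hp' using hp'
  choose q' hq' using hq'
  refine ⟨d, d', p', q', fun x hx ↦ (hf1 x).trans (hfd x hx), fun i hi ↦ ?_, fun i hi ↦ ?_, ?_, ?_⟩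
  · obtain ⟨a, ha⟩ := hmem (p' i)
    exact (hF _ a ha).trans_lt ((hp i hi).2 a (by rwa [← hp' i hi]))
  · by_contra h
    obtain ⟨a, ha⟩ := hmem (q' i)
    exact absurd ((hq i hi).2 a (by rwa [← hq' i hi]))
      (not_le.2 ((hf3 _ a ha).trans (hfd _ (not_le.1 h))))
  · rwa [Finset.sum_congr rfl fun i hi ↦ by rw [hp' i (Finset.mem_range.1 hi)]]
  · rwa [Finset.sum_congr rfl fun i hi ↦ by
      rw [hp' i (Finset.mem_range.1 hi), hq' i (Finset.mem_range.1 hi)]]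

/-! ### Rational vectors and their patterns -/

/-- The inclusion of the rational finitely supported families into the real ones. -/
noncomputable def castVec : (Omega1 →₀ ℚ) →+ C00 :=
  Finsupp.mapRange.addMonoidHom (Rat.castHom ℝ : ℚ →+ ℝ)

theorem castVec_single (a : Omega1) (t : ℚ) :
    castVec (Finsupp.single a t) = Finsupp.single a (t : ℝ) := by
  simp [castVec]

theorem exists_castVec_near (x : C00) {ε : ℝ} (hε : 0 < ε) :
    ∃ r, ell1 (x - castVec r) < ε := by
  induction x using Finsupp.induction_linear generalizing ε with
  | zero => exact ⟨0, by simpa using hε⟩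
  | add x x' h h' =>
    obtain ⟨r, hr⟩ := h (half_pos hε)
    obtain ⟨r', hr'⟩ := h' (half_pos hε)
    refine ⟨r + r', ?_⟩
    rw [map_add, add_sub_add_comm]
    linarith [map_add_le_add ell1 (x - castVec r) (x' - castVec r')]
  | single a t =>
    obtain ⟨q, h1, h2⟩ := exists_rat_btwn (show t < t + ε by linarith)
    refine ⟨Finsupp.single a q, ?_⟩
    rw [castVec_single, ← Finsupp.single_sub, ell1_single, abs_lt]
    constructor <;> linarith

theorem castVec_eq_vec {L : List Omega1} (hL : L.Nodup) {z : Omega1 →₀ ℚ}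
    (hz : ∀ a, a ∉ L → z a = 0) :
    castVec z = vec L fun i ↦ (((L.map z).getD i 0 : ℚ) : ℝ) := by
  induction L generalizing z with
  | nil =>
    obtain rfl : z = 0 := by ext a; exact hz a (by simp)
    simp [vec]
  | cons a L ih =>
    rw [List.nodup_cons] at hL
    have h := ih hL.2 (z := z.erase a) fun b hb ↦ by
      by_cases hab : b = a
      · subst hab; simp
      · rw [Finsupp.erase_ne hab]; exact hz b (by simp [hab, hb])
    have hmap : L.map (z.erase a) = L.map z := List.map_congr_left fun b hb ↦
      Finsupp.erase_ne fun hab ↦ hL.1 (hab ▸ hb)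
    rw [hmap] at h
    conv_lhs => rw [← Finsupp.single_add_erase a z, map_add, castVec_single, h]
    simp [vec]

/-- Two of uncountably many rational vectors agree below `c`. -/
theorem exists_agree_below (r : Omega1 → Omega1 →₀ ℚ) (c : Omega1) :
    ∃ b b', c ≤ b ∧ b < b' ∧ ∀ a < c, r b a = r b' a := by
  have := (countable_Iio_Omega1 c).to_subtype
  have hunc : ¬ Countable (Set.Ici c) := fun h ↦ by
    obtain ⟨b, hb⟩ := exists_gt_of_countable (Set.countable_coe_iff.1 h)
    exact lt_irrefl b (hb b (hb c Set.self_mem_Ici).le)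
  have hinj : ¬ Function.Injective fun b : Set.Ici c ↦
      (r b).subtypeDomain (· ∈ Set.Iio c) := fun h ↦
    hunc (h.countable (β := Set.Iio c →₀ ℚ))
  simp only [Function.Injective] at hinj
  push Not at hinj
  obtain ⟨b, b', h, hne⟩ := hinj
  have hag : ∀ a < c, r b a = r b' a := fun a ha ↦ DFunLike.congr_fun h ⟨a, ha⟩
  rcases lt_or_gt_of_ne (Subtype.coe_injective.ne hne) with hlt | hlt
  · exact ⟨b, b', b.2, hlt, hag⟩
  · exact ⟨b', b, b'.2, hlt, fun a ha ↦ (hag a ha).symm⟩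

/-- A function from `ω₁` to a countable type has a value that occurs cofinally often. -/
theorem exists_cofinal_value {β : Type*} [Countable β] (f : Omega1 → β) :
    ∃ v, ∀ c, ∃ c' ≥ c, f c' = v := by
  by_contra! h
  choose g hg using h
  obtain ⟨b, hb⟩ := exists_gt_range g
  exact hg (f b) b (hb _).le rfl

/-- From uncountably many rational vectors one obtains differences `r b - r b'` that are supported
arbitrarily far out and all have the same coefficient pattern. -/
theorem exists_uniform_differences (r : Omega1 → Omega1 →₀ ℚ) :
    ∃ (B B' : Omega1 → Omega1) (F : Omega1 → List Omega1) (n : ℕ) (k : ℕ → ℝ),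
      (∀ x, B x < B' x) ∧ (∀ x, x ≤ B x) ∧ (∀ x, (F x).length = n) ∧
      (∀ x, (F x).Pairwise (· < ·)) ∧ (∀ x, ∀ a ∈ F x, x ≤ a) ∧
      ∀ x, castVec (r (B x) - r (B' x)) = vec (F x) k := by
  choose b b' hb hbb' hag using exists_agree_below r
  let L : Omega1 → List Omega1 := fun c ↦ (r (b c) - r (b' c)).support.sort (· ≤ ·)
  obtain ⟨v, hv⟩ := exists_cofinal_value fun c ↦ (L c).map (r (b c) - r (b' c))
  choose g hg hgv using hv
  refine ⟨fun x ↦ b (g x), fun x ↦ b' (g x), fun x ↦ L (g x), v.length,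
    fun i ↦ ((v.getD i 0 : ℚ) : ℝ), fun x ↦ hbb' _, fun x ↦ (hg x).trans (hb _), fun x ↦ ?_,
    fun x ↦ (Finset.sortedLT_sort _).pairwise, fun x a ha ↦ ?_, fun x ↦ ?_⟩
  · rw [← hgv x, List.length_map]
  · refine (hg x).trans (le_of_not_gt fun h ↦ ?_)
    have h1 : (r (b (g x)) - r (b' (g x))) a ≠ 0 := by simpa [L] using ha
    exact h1 (by rw [Finsupp.sub_apply, hag _ a h, sub_self])
  · rw [← hgv x]
    exact castVec_eq_vec (Finset.sort_nodup _ _) fun a ha ↦ by simpa [L] using ha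

/-! ### The completed space and its basic sequences -/

theorem fullSum_eq {X : Type*} [NormedAddCommGroup X] [NormedSpace ℝ X] (y : Omega1 → X)
    (a : C00) : fullSum y a = Finsupp.linearCombination ℝ y a := rfl

theorem partialSum_eq {X : Type*} [NormedAddCommGroup X] [NormedSpace ℝ X] (y : Omega1 → X)
    (a : C00) (l : Omega1) :
    partialSum y a l = Finsupp.linearCombination ℝ y (initProj l a) := by
  classical
  rw [Finsupp.linearCombination_apply, Finsupp.sum, partialSum]
  refine Finset.sum_congr ?_ fun α hα ↦ ?_
  · ext α
    by_cases h : α < l <;> simp [restr_apply, h]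
  · have h : α < l := by
      by_contra h
      simp [restr_apply, h] at hα
    simp [restr_apply, h]

/-- A seminorm on a vector space is induced by a linear map onto a dense subspace of a Banach
space. -/
theorem exists_completion {E : Type} [AddCommGroup E] [Module ℝ E] (N : Seminorm ℝ E) :
    ∃ (X : Type) (_ : NormedAddCommGroup X) (_ : NormedSpace ℝ X) (_ : CompleteSpace X)
      (ι : E →ₗ[ℝ] X), (∀ x, ‖ι x‖ = N x) ∧ DenseRange ι := by
  let _ : SeminormedAddCommGroup E := N.toAddGroupSeminorm.toSeminormedAddCommGroup
  have hnorm : ∀ x : E, ‖x‖ = N x := fun _ ↦ rfl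
  let _ : NormedSpace ℝ E := ⟨fun t x ↦ by rw [hnorm, hnorm, map_smul_eq_mul]⟩
  refine ⟨UniformSpace.Completion E, inferInstance, inferInstance, inferInstance,
    (UniformSpace.Completion.toComplₗᵢ (𝕜 := ℝ) (E := E)).toLinearMap, fun x ↦ ?_, ?_⟩
  · exact (UniformSpace.Completion.norm_coe x).trans (hnorm x)
  · exact UniformSpace.Completion.denseRange_coe

section Completed

variable {X : Type*} [NormedAddCommGroup X] [NormedSpace ℝ X]

theorem Good.isKBasis {K : ℝ} {N : Seminorm ℝ C00} (hN : Good K N) {ι : C00 →ₗ[ℝ] X}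
    (hι : ∀ x, ‖ι x‖ = N x) (hd : DenseRange ι) :
    (∀ α, ‖ι (Finsupp.single α 1)‖ = 1) ∧ IsKBasis K fun α ↦ ι (Finsupp.single α 1) := by
  have hnorm : ∀ α, ‖ι (Finsupp.single α 1)‖ = 1 := fun α ↦ by rw [hι, hN.single]
  have hsum : ∀ x, Finsupp.linearCombination ℝ (fun α ↦ ι (Finsupp.single α 1)) x = ι x := by
    intro x
    induction x using Finsupp.induction_linear with
    | zero => simp
    | add x x' h h' => rw [map_add, map_add, h, h']
    | single a t => simp [← map_smul]
  refine ⟨hnorm, ⟨fun α h ↦ ?_, fun l a ↦ ?_⟩, ?_⟩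
  · have := hnorm α
    simp [h] at this
  · rw [partialSum_eq, fullSum_eq, hsum, hsum, hι, hι]
    exact hN.initProj_le l a
  · refine (hd.mono ?_).closure_eq
    rintro _ ⟨x, rfl⟩
    rw [← hsum x]
    exact Finsupp.mem_span_range_iff_exists_finsupp.2 ⟨x, rfl⟩

/-- The choice of the approximation accuracy `ε` and of the number `m` of blocks. -/
theorem exists_accuracy {K K' : ℝ} (hK' : 1 ≤ K') (h : K' < K) :
    ∃ ε > 0, ∃ m : ℕ, 2 * ε < K'⁻¹ ∧ ∀ ζ, K'⁻¹ - 2 * ε ≤ ζ →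
      K' * ((m + K) * ζ / K + m * (4 * ε)) < m * ζ - m * (2 * ε) := by
  have hK0 : 0 < K := by linarith
  have hK0' : 0 < K' := by linarith
  obtain ⟨η, hη⟩ : ∃ η, η = 1 - K' / K := ⟨_, rfl⟩
  have hη0 : 0 < η := by rw [hη, sub_pos, div_lt_one hK0]; exact h
  obtain ⟨δ, hδ⟩ : ∃ δ, δ = η / (2 + 4 * K' + η) := ⟨_, rfl⟩
  have hδ0 : 0 < δ := by rw [hδ]; positivity
  have hδη : δ * (2 + 4 * K' + η) = η := by rw [hδ]; field_simp
  have hδ1 : δ < 1 := by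
    rw [hδ, div_lt_one (by positivity)]; linarith
  have hi : 0 < K'⁻¹ := by positivity
  obtain ⟨m, hm⟩ := exists_nat_gt (2 * K' / η)
  have hm0 : (0 : ℝ) < m := lt_trans (by positivity) hm
  rw [div_lt_iff₀ hη0] at hm
  refine ⟨K'⁻¹ * δ / 4, by positivity, m, by nlinarith, fun ζ hζ ↦ ?_⟩
  have hζ0 : 0 < ζ := lt_of_lt_of_le (by nlinarith) hζ
  have e1 : K' * ((m + K) * ζ / K) = m * ζ * (1 - η) + K' * ζ := by
    rw [hη]; field_simp; ring
  rw [mul_add, e1]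
  have h1 : K' * ζ < m * η / 2 * ζ := mul_lt_mul_of_pos_right (by linarith) hζ0
  have h2 : (K'⁻¹ - 2 * (K'⁻¹ * δ / 4)) * (η / 2) ≤ ζ * (η / 2) :=
    mul_le_mul_of_nonneg_right hζ (by positivity)
  have h3 : (K'⁻¹ * δ / 4) * (2 + 4 * K' + η) = K'⁻¹ * η / 4 := by
    rw [show K'⁻¹ * δ / 4 * (2 + 4 * K' + η) = K'⁻¹ / 4 * (δ * (2 + 4 * K' + η)) by ring, hδη]
    ring
  have h4 : (K'⁻¹ * δ / 4) * (2 + 4 * K') < ζ * (η / 2) := by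
    have : 0 < K'⁻¹ * η := by positivity
    nlinarith
  have h5 := mul_lt_mul_of_pos_left h4 hm0
  linarith

theorem norm_map_sum_sub_le {N : Seminorm ℝ C00} {ι : C00 →ₗ[ℝ] X} (hι : ∀ x, ‖ι x‖ = N x)
    (Y : C00 →ₗ[ℝ] X) {x w : ℕ → C00} {δ : ℝ} (h : ∀ i, ‖ι (x i) - Y (w i)‖ ≤ δ) (m : ℕ) :
    |N (∑ i ∈ Finset.range m, x i) - ‖Y (∑ i ∈ Finset.range m, w i)‖| ≤ m * δ := by
  rw [← hι]
  refine (abs_norm_sub_norm_le _ _).trans ?_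
  rw [map_sum, map_sum, ← Finset.sum_sub_distrib]
  refine (norm_sum_le_of_le _ fun i _ ↦ h i).trans ?_
  simp

/-- If `N` has the block property of `exists_good_seminorm`, then the completion has no uncountable
`K'`-basic sequence with `K' < K`. -/
theorem not_isKBasicSeq {K K' : ℝ} {N : Seminorm ℝ C00} (hN : Good K N)
    (hblocks : ∀ (F : Omega1 → List Omega1) (n : ℕ), 0 < n → (∀ x, (F x).length = n) →
      (∀ x, (F x).Pairwise (· < ·)) → (∀ x, ∀ a ∈ F x, x ≤ a) →
      ∀ (f : Omega1 → Omega1) (c : ℕ → ℝ) (m : ℕ), ∃ (d b : Omega1) (p q : ℕ → Omega1),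
        (∀ x < d, f x < d) ∧ (∀ i < m, p i < d) ∧ (∀ i < m, d ≤ q i) ∧
        m * N (vec (F b) c) ≤ N (∑ i ∈ Finset.range m, vec (F (p i)) c) ∧
        N (∑ i ∈ Finset.range m, (vec (F (p i)) c - vec (F (q i)) c)) ≤
          (m + K) * N (vec (F b) c) / K)
    {ι : C00 →ₗ[ℝ] X} (hι : ∀ x, ‖ι x‖ = N x) (hd : DenseRange ι) (hK' : 1 ≤ K') (hlt : K' < K)
    (y : Omega1 → X) : ¬ IsKBasicSeq K' y := by
  classical
  intro hy
  have hK0 : 0 < K' := by linarith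
  obtain ⟨ε, hε, m, hε2, hm⟩ := exists_accuracy hK' hlt
  obtain ⟨Y, hY⟩ : ∃ Y, Y = Finsupp.linearCombination ℝ y := ⟨_, rfl⟩
  have hproj : ∀ l a, ‖Y (initProj l a)‖ ≤ K' * ‖Y a‖ := fun l a ↦ by
    rw [hY, ← partialSum_eq, ← fullSum_eq]; exact hy.norm_partialSum_le l a
  -- the normalized sequence
  obtain ⟨u, hu⟩ : ∃ u : Omega1 → C00, u = fun α ↦ Finsupp.single α ‖y α‖⁻¹ := ⟨_, rfl⟩
  have hYu : ∀ α, ‖Y (u α)‖ = 1 := fun α ↦ by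
    have := norm_ne_zero_iff.2 (hy.ne_zero α)
    simp [hY, hu, norm_smul, this]
  have hu_lt : ∀ {α l}, α < l → initProj l (u α) = u α := fun {α l} h ↦ by
    rw [hu, restr_single, if_pos (Set.mem_Iio.2 h)]
  have hu_le : ∀ {α l}, l ≤ α → initProj l (u α) = 0 := fun {α l} h ↦ by
    rw [hu, restr_single, if_neg (by simpa using h)]
  have happ : ∀ α, ∃ r, ‖ι (castVec r) - Y (u α)‖ < ε := fun α ↦ by
    obtain ⟨x, hx⟩ := hd.exists_dist_lt (Y (u α)) (half_pos hε)
    obtain ⟨r, hr⟩ := exists_castVec_near x (half_pos hε)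
    refine ⟨r, ?_⟩
    have h1 : ‖ι x - ι (castVec r)‖ < ε / 2 := by
      rw [← map_sub, hι]; exact (hN.le_ell1 _).trans_lt hr
    rw [dist_eq_norm] at hx
    rw [norm_sub_rev]
    linarith [norm_sub_le_norm_sub_add_norm_sub (Y (u α)) (ι x) (ι (castVec r))]
  choose r hr using happ
  obtain ⟨B, B', F, n, k, hBB', hB, hlen, hsort, hF, hvec⟩ := exists_uniform_differences r
  obtain ⟨w, hw⟩ : ∃ w : Omega1 → C00, w = fun x ↦ u (B x) - u (B' x) := ⟨_, rfl⟩
  have hnear : ∀ x, ‖ι (vec (F x) k) - Y (w x)‖ ≤ 2 * ε := fun x ↦ by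
    rw [← hvec, hw, map_sub, map_sub, map_sub, sub_sub_sub_comm]
    linarith [norm_sub_le (ι (castVec (r (B x))) - Y (u (B x)))
      (ι (castVec (r (B' x))) - Y (u (B' x))), hr (B x), hr (B' x)]
  have hlow : ∀ x, K'⁻¹ - 2 * ε ≤ N (vec (F x) k) := fun x ↦ by
    have h1 := hproj (B' x) (w x)
    have h2 : initProj (B' x) (w x) = u (B x) := by
      rw [hw, map_sub, hu_lt (hBB' x), hu_le le_rfl, sub_zero]
    rw [h2, hYu, ← inv_le_iff_one_le_mul₀' hK0] at h1
    rw [← hι]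
    linarith [abs_le.1 ((abs_norm_sub_norm_le _ _).trans (hnear x))]
  obtain ⟨o⟩ : Nonempty Omega1 := inferInstance
  have hn : 0 < n := Nat.pos_of_ne_zero fun h0 ↦ by
    have h1 := hlow o
    rw [List.length_eq_zero_iff.1 ((hlen o).trans h0)] at h1
    simp only [vec, map_zero] at h1
    linarith
  obtain ⟨d, b, p, q, hfd, hp, hq, h1, h2⟩ := hblocks F n hn hlen hsort hF B' k m
  -- cutting the difference of the two sums at `d` leaves the first sum
  have hcut : initProj d (∑ i ∈ Finset.range m, (w (p i) - w (q i))) =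
      ∑ i ∈ Finset.range m, w (p i) := by
    rw [map_sum]
    refine Finset.sum_congr rfl fun i hi ↦ ?_
    rw [Finset.mem_range] at hi
    have hBp := hfd _ (hp i hi)
    have hBq := (hq i hi).trans (hB (q i))
    rw [map_sub, hw, map_sub, map_sub, hu_lt hBp, hu_lt ((hBB' _).trans hBp), hu_le hBq,
      hu_le (hBq.trans (hBB' _).le), sub_zero, sub_zero]
  have h3 := hproj d (∑ i ∈ Finset.range m, (w (p i) - w (q i)))
  rw [hcut] at h3
  have h4 := (abs_le.1 (norm_map_sum_sub_le hι Y (fun i ↦ hnear (p i)) m)).2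
  have h5 := (abs_le.1 (norm_map_sum_sub_le hι Y (x := fun i ↦ vec (F (p i)) k - vec (F (q i)) k)
    (w := fun i ↦ w (p i) - w (q i)) (δ := 4 * ε) (fun i ↦ by
      rw [map_sub, map_sub, sub_sub_sub_comm]
      linarith [norm_sub_le (ι (vec (F (p i)) k) - Y (w (p i)))
        (ι (vec (F (q i)) k) - Y (w (q i))), hnear (p i), hnear (q i)]) m)).1
  have h6 := hm _ (hlow b)
  have h7 : K' * ‖Y (∑ i ∈ Finset.range m, (w (p i) - w (q i)))‖ ≤
      K' * ((m + K) * N (vec (F b) k) / K + m * (4 * ε)) :=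
    mul_le_mul_of_nonneg_left (by linarith) hK0.le
  linarith

end Completed

theorem theorem2 (hDiamond : JensenDiamond) (K : ℝ) (hK : 1 < K) :
    ∃ (X : Type) (_ : NormedAddCommGroup X) (_ : NormedSpace ℝ X) (_ : CompleteSpace X),
      (∃ e : Omega1 → X, (∀ α, ‖e α‖ = 1) ∧ IsKBasis K e) ∧
        ∀ K' : ℝ, 1 ≤ K' → K' < K → ¬ ∃ y : Omega1 → X, IsKBasicSeq K' y := by
  obtain ⟨N, hN, hblocks⟩ := exists_good_seminorm hDiamond hK.le
  obtain ⟨X, i1, i2, i3, ι, hι, hd⟩ := exists_completion N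
  refine ⟨X, i1, i2, i3, ⟨_, hN.isKBasis hι hd⟩, fun K' h1 h2 ⟨y, hy⟩ ↦ ?_⟩
  exact not_isKBasicSeq hN hblocks hι hd h1 h2 y hy
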